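/- Let $\alpha>-\tfrac12$ and $a\in\mathbb R$, $a\neq 0$, and let $$\Delta_{\alpha,a}\,u(r)=r^{-(2\alpha+1)}\frac{d}{dr}\Big(r^{2\alpha+1}\frac{d}{dr}u(r)\Big)-a^2u(r)$$ be the shifted Bessel operator on $\mathbb R^+=(0,\infty)$. Let $f\in L^2(\mathbb R^+,r^{2\alpha+1}dr)$ be complex valued and such that for every $m\in\mathbb N$ the function $\Delta_{\alpha,a}^m f$, taken in the sense of distributions on $(0,\infty)$, belongs to $L^2(\mathbb R^+,r^{2\alpha+1}dr)$; that is, $\Delta_{\alpha,a}^m f\in L^2(\mathbb R^+,r^{2\alpha+1}dr)$ satisfies $$\int_0^\infty (\Delta_{\alpha,a}^m f)(r)\,\varphi(r)\,r^{2\alpha+1}dr=\int_0^\infty f(r)\,(\Delta_{\alpha,a}^m\varphi)(r)\,r^{2\alpha+1}dr\qquad\text{for all }\varphi\in C_c^\infty((0,\infty)).$$ Assume that the Carleman condition $$\sum_{m=1}^\infty \|\Delta_{\alpha,a}^m f\|_2^{-1/(2m)}=\infty$$ holds, where $\|\cdot\|_2$ is the norm of $L^2(\mathbb R^+,r^{2\alpha+1}dr)$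 and $0^{-1/(2m)}=+\infty$. Then $f$ cannot vanish in a neighbourhood of $0$ unless it is identically zero: if there is $\eta>0$ such that $f=0$ almost everywhere on $(0,\eta)$, then $f=0$ almost everywhere on $(0,\infty)$. -/

import Mathlib

open MeasureTheory Set
open scoped ContDiff ENNReal

/-- The measure `r^(2α+1) dr` on the half line `ℝ⁺ = (0, ∞)`. -/
noncomputable def besselMeasure (α : ℝ) : Measure ℝ :=
  (volume.restrict (Ioi (0 : ℝ))).withDensity (fun r => ENNReal.ofReal (r ^ (2 * α + 1)))

/-- The shifted Bessel operator on smooth functions on `(0, ∞)`: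
`Δ_{α,a} φ (r) = r^{-(2α+1)} d/dr (r^{2α+1} dφ/dr) - a² φ(r)`. -/
noncomputable def besselOp (α a : ℝ) (φ : ℝ → ℂ) : ℝ → ℂ := fun r =>
  (r ^ (-(2 * α + 1)) : ℝ) • deriv (fun s : ℝ => (s ^ (2 * α + 1) : ℝ) • deriv φ s) r
    - (a ^ 2 : ℝ) • φ r

/-- Test functions: elements of `C_c^∞((0, ∞))`, extended by zero to the real line. -/
structure IsTestFunction (φ : ℝ → ℂ) : Prop where
  smooth : ContDiff ℝ ∞ φ
  hasCompactSupport : HasCompactSupport φ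
  tsupport_subset : tsupport φ ⊆ Ioi (0 : ℝ)

/-- `Δ_{α,a}^m f = g` on `(0, ∞)` in the sense of distributions, where functions are paired with
respect to the measure `r^(2α+1) dr`, for which `Δ_{α,a}` is formally self-adjoint. -/
def IsWeakBesselPow (α a : ℝ) (m : ℕ) (f g : ℝ → ℂ) : Prop :=
  ∀ φ : ℝ → ℂ, IsTestFunction φ →
    ∫ r, f r * ((besselOp α a)^[m] φ) r ∂(besselMeasure α) =
      ∫ r, g r * φ r ∂(besselMeasure α)

/-!
Let `μ` be the measure `r ^ (2 α + 1) dr` on the half line and suppose that `f` vanishes on `(0, η)`.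
The idea is to pair `f` with the solutions of the eigenvalue equation which decay at infinity. Their
singularity at the origin does no harm, since `f` and all the functions `Δ ^ m f` vanish there; this
is where the vanishing near `0` enters, and it replaces spectral theory and the Hankel transform.

The decaying solutions are `r ↦ ψ (k r)`, `0 < re k`, where `ψ` is the Macdonald kernel, given by the
integral of `u ^ (α - 1/2) (1 + u) ^ (-1/2) exp (-z √(1 + u))` over `u > 0`; they satisfy
`Δ ψ(k ·) = (k² - a²) ψ(k ·)` (`hasDerivAt_macdonaldKernel'_mul`). Put `F k = ∫ f(r) ψ(k r) dμ(r)`.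

* Moving the operator onto the kernel (`integral_mul_eigenfunction`, with cut-offs) gives
  `(k² - a²) ^ m F k = ∫ (Δ ^ m f)(r) ψ(k r) dμ(r)`, so that `|k² - a²| ^ m |F k| ≤ K ‖Δ ^ m f‖₂`
  uniformly in every half plane `c ≤ re k`, `0 < c`.
* `F` is holomorphic, because `F` is the Laplace transform of the variable `r √(1 + u)` under the
  complex measure `f(r) u ^ (α - 1/2) (1 + u) ^ (-1/2) dμ(r) du` (`laplaceOf_radialDensity`).
* A function with such bounds vanishes at every large real point under Carleman's condition
  (`eq_zero_of_carleman_bound`). Indeed, after the substitution `k = c / (1 - w)`, the bounds make the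
  mean of `log |F|` over the circles `|w| = ρ` tend to `-∞` as `ρ → 1`, while by Jensen's
  inequality these means are at least `log |F c|`. No logarithmic convexity of the norms is needed:
  the best of the first `N` bounds at a point is at least as good as the number of indices `n < N`
  whose bound is effective there, because that number is at most one more than the largest of them.
* By uniqueness of Laplace transforms (`LaplaceIntegrable.integral_comp_mul_eq_zero`) the complex
  measure above annihilates every function of `s = r √(1 + u)`. For `s exp (-x s²)` the integral over
  `u` is a Gamma integral, and what remains is `∫ f(r) r ^ (-2 α) exp (-x r²) dμ(r) = 0` for all
  `0 < x`. This is a Laplace transform in the variable `r²`, and uniqueness once more gives `f = 0`.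
-/

/-! ### Jensen's inequality and Carleman's condition -/

/-- Jensen's inequality: `log ‖G‖` is subharmonic. -/
theorem log_norm_le_circleAverage {G : ℂ → ℂ} {ρ : ℝ} (hρ : 0 < ρ)
    (hG : AnalyticOnNhd ℂ G (Metric.closedBall 0 ρ)) (h0 : G 0 ≠ 0) :
    Real.log ‖G 0‖ ≤ Real.circleAverage (fun z => Real.log ‖G z‖) 0 ρ := by
  have hG' : AnalyticOnNhd ℂ G (Metric.closedBall 0 |ρ|) := by rwa [abs_of_pos hρ]
  rw [hG'.circleAverage_log_norm hρ.ne' h0]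
  refine le_add_of_nonneg_left (finsum_nonneg fun u => ?_)
  by_cases hu : u ∈ Metric.closedBall (0 : ℂ) |ρ|
  · refine mul_nonneg (mod_cast MeromorphicOn.AnalyticOnNhd.divisor_nonneg hG' u) ?_
    by_cases hu0 : u = 0
    · simp [hu0]
    · apply Real.log_nonneg
      have h1 : 0 < ‖u‖ := norm_pos_iff.mpr hu0
      have h2 : ‖u‖ ≤ ρ := by simpa [abs_of_pos hρ] using hu
      rw [zero_sub, norm_neg, ← div_eq_mul_inv, le_div_iff₀ h1]
      linarith
  · simp [hu]

/-- The zeros of an analytic function which does not vanish at the centre are negligible on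
circles. Upper bounds for `log ‖G‖` fail at the zeros, where `Real.log` takes the value `0`. -/
theorem ae_circleMap_ne_zero {G : ℂ → ℂ} {ρ : ℝ} (hρ : 0 < ρ)
    (hG : AnalyticOnNhd ℂ G (Metric.closedBall 0 ρ)) (h0 : G 0 ≠ 0) :
    ∀ᵐ θ : ℝ ∂volume, G (circleMap 0 ρ θ) ≠ 0 := by
  have h1 := hG.preimage_zero_mem_codiscreteWithin h0 (Metric.mem_closedBall_self hρ.le)
    ⟨⟨0, Metric.mem_closedBall_self hρ.le⟩, (convex_closedBall _ _).isPreconnected⟩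
  have h2 : G ⁻¹' {0}ᶜ ∈ Filter.codiscreteWithin (Metric.sphere (0 : ℂ) |ρ|) := by
    rw [abs_of_pos hρ]
    exact Filter.codiscreteWithin_mono Metric.sphere_subset_closedBall h1
  have h3 := circleMap_preimage_codiscrete hρ.ne' h2
  have h4 := ae_restrict_le_codiscreteWithin (μ := volume) MeasurableSet.univ
    (Filter.mem_map.mp h3)
  rw [Measure.restrict_univ] at h4
  filter_upwards [h4] with θ hθ using hθ

/-- A function on the half plane `c / 2 < re z` which decays as fast as a Carleman sequence allows
vanishes at the real point `c`. The half plane is the image of the unit disc under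
`w ↦ c / (1 - w)`. -/
theorem eq_zero_of_carleman_bound {F : ℂ → ℂ} {c C : ℝ} (hc : 0 < c)
    (hF : DifferentiableOn ℂ F {z | c / 2 < z.re}) {x : ℕ → ℝ} (hx : ∀ n, 0 < x n)
    (hsum : ¬ Summable x) (hb0 : ∀ z : ℂ, c / 2 < z.re → ‖F z‖ ≤ C)
    (hb : ∀ (n : ℕ) (z : ℂ), c / 2 < z.re → ‖F z‖ * (x n * ‖z‖) ^ (2 * (n + 1)) ≤ C) :
    F c = 0 := by
  by_contra hFc
  have hre : ∀ w : ℂ, ‖w‖ < 1 → c / 2 < ((c : ℂ) / (1 - w)).re := by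
    intro w hw
    have h1 : (1 - w) ≠ 0 := by
      intro h
      have : w = 1 := by linear_combination -h
      simp [this] at hw
    have h2 : 0 < Complex.normSq (1 - w) := Complex.normSq_pos.mpr h1
    have h3 : w.re ^ 2 + w.im ^ 2 < 1 := by
      have := Complex.sq_norm w
      rw [Complex.normSq_apply] at this
      nlinarith [norm_nonneg w]
    rw [Complex.div_re]
    simp only [Complex.ofReal_re, Complex.ofReal_im, zero_mul, zero_div, add_zero,
      Complex.sub_re, Complex.one_re]
    rw [lt_div_iff₀ h2, Complex.normSq_apply]
    simp only [Complex.sub_re, Complex.one_re, Complex.sub_im, Complex.one_im]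
    nlinarith
  set G : ℂ → ℂ := fun w => F ((c : ℂ) / (1 - w)) with hGdef
  have hG0 : G 0 ≠ 0 := by simpa [hGdef] using hFc
  have hGd : DifferentiableOn ℂ G (Metric.ball 0 1) := by
    refine hF.comp ?_ fun w hw => hre w (by simpa using hw)
    intro w hw
    have h1 : (1 - w) ≠ 0 := by
      intro h
      have : w = 1 := by linear_combination -h
      simp [this] at hw
    have : DifferentiableAt ℂ (fun w : ℂ => (c : ℂ) / (1 - w)) w :=
      (differentiableAt_const _).div (by fun_prop) h1
    exact this.differentiableWithinAt
  have hGan : AnalyticOnNhd ℂ G (Metric.ball 0 1) := hGd.analyticOnNhd Metric.isOpen_ball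
  have hFcpos : 0 < ‖G 0‖ := norm_pos_iff.mpr hG0
  have hCpos : 0 < C := lt_of_lt_of_le (norm_pos_iff.mpr hFc) (hb0 c (by simpa using by linarith))
  set b : ℝ := c / Real.exp 1 with hbdef
  have hbpos : 0 < b := div_pos hc (Real.exp_pos 1)
  set y : ℕ → ℝ := fun n => min 1 (b * x n / 2) with hydef
  have hypos : ∀ n, 0 < y n := fun n => lt_min one_pos (by have := hx n; positivity)
  have hysum : ¬ Summable y := by
    intro h
    apply hsum
    have h0 := h.tendsto_atTop_zero
    have h1 : ∀ᶠ n in Filter.atTop, y n < 1 := h0.eventually (gt_mem_nhds one_pos)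
    have h2 : Summable fun n => b / 2 * x n := by
      refine (summable_congr_atTop (f₁ := y) ?_).mp h
      filter_upwards [h1] with n hn
      have : y n = b * x n / 2 := by
        rcases min_choice 1 (b * x n / 2) with h | h
        · simp only [hydef] at hn; rw [h] at hn; exact absurd hn (lt_irrefl _)
        · exact h
      rw [this]; ring
    exact (summable_mul_left_iff (by positivity)).mp h2
  -- The partial sums of `y` are bounded by a multiple of `log (C / ‖G 0‖)`.
  have key : ∀ N : ℕ, ∑ n ∈ Finset.range N, y n ≤
      2 * Real.pi * (Real.log C - Real.log ‖G 0‖) := by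
    intro N
    obtain ⟨ε, hε0, hε1, hεy⟩ : ∃ ε : ℝ, 0 < ε ∧ ε < 1 ∧ ∀ n ∈ Finset.range N, ε ≤ y n := by
      have hev : ∀ᶠ ε in nhdsWithin (0 : ℝ) (Ioi 0), ∀ n ∈ Finset.range N, ε ≤ y n := by
        rw [Filter.eventually_all_finset]
        intro n _
        exact (eventually_le_nhds (hypos n)).filter_mono nhdsWithin_le_nhds
      have hev1 : ∀ᶠ ε in nhdsWithin (0 : ℝ) (Ioi 0), ε < 1 :=
        (eventually_lt_nhds one_pos).filter_mono nhdsWithin_le_nhds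
      obtain ⟨ε, h1, h2, h3⟩ := (hev.and (hev1.and self_mem_nhdsWithin)).exists
      exact ⟨ε, h3, h2, h1⟩
    -- With `ε ≤ y n`, the point `ρ exp (i θ)` is within `b * x n` of `1` for `0 ≤ θ ≤ y n`.
    set ρ : ℝ := 1 - ε with hρdef
    have hρ0 : 0 < ρ := by linarith
    have hρ1 : ρ < 1 := by linarith
    have hGρ : AnalyticOnNhd ℂ G (Metric.closedBall 0 ρ) :=
      hGan.mono (Metric.closedBall_subset_ball hρ1)
    set f₂ : ℝ → ℝ := fun θ => Real.log C -
      ∑ n ∈ Finset.range N, (Icc 0 (y n)).indicator (fun _ => (1 : ℝ)) θ with hf₂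
    have hpt : ∀ θ ∈ Icc 0 (2 * Real.pi), G (circleMap 0 ρ θ) ≠ 0 →
        Real.log ‖G (circleMap 0 ρ θ)‖ ≤ f₂ θ := by
      intro θ hθ hne
      set w := circleMap 0 ρ θ with hw
      have hwn : ‖w‖ = ρ := by rw [hw, norm_circleMap_zero, abs_of_pos hρ0]
      have hw1 : ‖w‖ < 1 := by rw [hwn]; exact hρ1
      have hz := hre w hw1
      set z := (c : ℂ) / (1 - w) with hzdef
      have hpos : 0 < ‖F z‖ := norm_pos_iff.mpr hne
      have hdist : ‖1 - w‖ ≤ ε + θ := by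
        have h1 : (1 : ℂ) - w = (ε : ℂ) - ρ * (Complex.exp (Complex.I * θ) - 1) := by
          rw [hw, circleMap, hρdef]
          push_cast
          rw [mul_comm Complex.I]
          ring
        rw [h1]
        refine (norm_sub_le _ _).trans ?_
        rw [norm_mul, Complex.norm_real, Complex.norm_real, Real.norm_of_nonneg hε0.le,
          Real.norm_of_nonneg hρ0.le]
        have h2 := Real.norm_exp_I_mul_ofReal_sub_one_le (x := θ)
        rw [Real.norm_of_nonneg hθ.1] at h2
        have h3 := norm_nonneg (Complex.exp (Complex.I * θ) - 1)
        nlinarith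
      have hdpos : 0 < ‖1 - w‖ := by
        rw [norm_pos_iff]
        intro h
        have : w = 1 := by linear_combination -h
        simp [this] at hw1
      have hbound : ∀ n ∈ Finset.range N, θ ∈ Icc 0 (y n) →
          Real.log ‖F z‖ ≤ Real.log C - (n + 1) := by
        intro n hn hθn
        have h1 : ‖1 - w‖ ≤ b * x n := by
          have := hεy n hn
          have h4 : y n ≤ b * x n / 2 := min_le_right _ _
          linarith [hθn.2]
        have h2 : Real.exp 1 ≤ x n * ‖z‖ := by
          rw [hzdef, norm_div, Complex.norm_real, Real.norm_of_nonneg hc.le, mul_div_assoc',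
            le_div_iff₀ hdpos]
          calc Real.exp 1 * ‖1 - w‖ ≤ Real.exp 1 * (b * x n) := by gcongr
            _ = x n * c := by rw [hbdef]; field_simp
        have h3 := hb n z hz
        have h4 : ‖F z‖ * Real.exp (n + 1) ≤ C := by
          refine le_trans ?_ h3
          gcongr
          calc Real.exp (n + 1) ≤ Real.exp ((2 * (n + 1) : ℕ) * 1) := by
                apply Real.exp_le_exp.mpr; push_cast; nlinarith [n.cast_nonneg (α := ℝ)]
            _ = Real.exp 1 ^ (2 * (n + 1)) := Real.exp_nat_mul 1 _
            _ ≤ _ := by gcongr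
        have h5 := Real.log_le_log (by positivity) h4
        rw [Real.log_mul hpos.ne' (Real.exp_pos _).ne', Real.log_exp] at h5
        linarith
      -- The number of active indices is at most one more than the largest of them.
      set S := (Finset.range N).filter fun n => θ ∈ Icc 0 (y n) with hS
      have hsumS : ∑ n ∈ Finset.range N, (Icc 0 (y n)).indicator (fun _ => (1 : ℝ)) θ = S.card := by
        rw [hS, Finset.card_filter, Nat.cast_sum]
        refine Finset.sum_congr rfl fun n _ => ?_
        by_cases h : θ ∈ Icc 0 (y n)
        · simp [h]
        · rw [indicator_of_notMem h]
          simp only [if_neg h, Nat.cast_zero]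
      change Real.log ‖F z‖ ≤ Real.log C - _
      rw [hsumS]
      rcases S.eq_empty_or_nonempty with hSe | hSn
      · simpa [hSe] using Real.log_le_log hpos (hb0 z hz)
      · have hmax := S.max'_mem hSn
        have hcard : S.card ≤ S.max' hSn + 1 := by
          have : S ⊆ Finset.range (S.max' hSn + 1) := fun n hn =>
            Finset.mem_range.mpr (Nat.lt_succ_of_le (S.le_max' n hn))
          simpa using Finset.card_le_card this
        have hm := Finset.mem_filter.mp hmax
        have h6 := hbound _ hm.1 hm.2
        have h7 : (S.card : ℝ) ≤ (S.max' hSn : ℝ) + 1 := by exact_mod_cast hcard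
        linarith
    have hint1 : IntervalIntegrable (fun θ => Real.log ‖G (circleMap 0 ρ θ)‖) volume 0
        (2 * Real.pi) := by
      refine MeromorphicOn.circleIntegrable_log_norm (c := 0) (R := ρ) (f := G) ?_
      rw [abs_of_pos hρ0]
      exact (hGρ.mono Metric.sphere_subset_closedBall).meromorphicOn
    have hind : ∀ n, Integrable ((Icc 0 (y n)).indicator (fun _ : ℝ => (1 : ℝ))) volume :=
      fun n => (integrable_indicator_iff measurableSet_Icc).mpr (by simp)
    have hint2 : IntervalIntegrable f₂ volume 0 (2 * Real.pi) :=
      intervalIntegrable_const.sub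
        (integrable_finsetSum _ fun n _ => hind n).intervalIntegrable
    have hle := intervalIntegral.integral_mono_ae_restrict Real.two_pi_pos.le hint1 hint2 (by
      rw [Filter.EventuallyLE, ae_restrict_iff' measurableSet_Icc]
      filter_upwards [ae_circleMap_ne_zero hρ0 hGρ hG0] with θ hθ hmem using hpt θ hmem hθ)
    have hval : ∫ θ in (0)..(2 * Real.pi), f₂ θ =
        2 * Real.pi * Real.log C - ∑ n ∈ Finset.range N, y n := by
      rw [hf₂, intervalIntegral.integral_sub intervalIntegrable_const
        (integrable_finsetSum _ fun n _ => hind n).intervalIntegrable,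
        intervalIntegral.integral_finsetSum fun n _ => (hind n).intervalIntegrable]
      congr 1
      · simp
      · refine Finset.sum_congr rfl fun n _ => ?_
        rw [intervalIntegral.integral_of_le Real.two_pi_pos.le, ← integral_Icc_eq_integral_Ioc,
          setIntegral_indicator measurableSet_Icc]
        have hy2 : y n ≤ 2 * Real.pi := (min_le_left _ _).trans (by linarith [Real.pi_gt_three])
        have : Icc 0 (2 * Real.pi) ∩ Icc 0 (y n) = Icc 0 (y n) :=
          inter_eq_right.mpr (Icc_subset_Icc_right hy2)
        rw [this]
        simp [(hypos n).le]
    have hJ := log_norm_le_circleAverage hρ0 hGρ hG0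
    rw [Real.circleAverage_def, smul_eq_mul, inv_mul_eq_div, le_div_iff₀ Real.two_pi_pos] at hJ
    rw [hval] at hle
    linarith
  exact hysum (summable_of_sum_range_le (fun n => (hypos n).le) key)

/-! ### Laplace transforms with respect to a nonnegative variable -/

section Laplace

variable {Ω : Type*} [MeasurableSpace Ω]

/-- The Laplace transform `z ↦ ∫ exp (-z X) H dμ` of the distribution of the variable `X` under
the complex measure `H μ`. -/
noncomputable def laplaceOf (μ : Measure Ω) (X : Ω → ℝ) (H : Ω → ℂ) (z : ℂ) : ℂ :=
  ∫ p, Complex.exp (-z * X p) * H p ∂μ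

/-- The standing conditions under which the Laplace transform of `X` under `H μ` is holomorphic on
the right half plane. -/
structure LaplaceIntegrable (μ : Measure Ω) (X : Ω → ℝ) (H : Ω → ℂ) : Prop where
  measurable : Measurable X
  nonneg : ∀ᵐ p ∂μ, 0 ≤ X p
  aestronglyMeasurable : AEStronglyMeasurable H μ
  integrable : ∀ x : ℝ, 0 < x → Integrable (fun p => Real.exp (-x * X p) * ‖H p‖) μ

variable {μ : Measure Ω} {X : Ω → ℝ} {H : Ω → ℂ}

theorem norm_cexp_neg_mul_ofReal (z : ℂ) (x : ℝ) :
    ‖Complex.exp (-z * x)‖ = Real.exp (-z.re * x) := by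
  rw [Complex.norm_exp]; simp

theorem LaplaceIntegrable.aestronglyMeasurable_exp_mul (h : LaplaceIntegrable μ X H) (z : ℂ) :
    AEStronglyMeasurable (fun p => Complex.exp (-z * X p) * H p) μ := by
  have := h.measurable
  exact (Measurable.aestronglyMeasurable (by fun_prop)).mul h.aestronglyMeasurable

theorem LaplaceIntegrable.integrable_exp_mul (h : LaplaceIntegrable μ X H) {z : ℂ}
    (hz : 0 < z.re) : Integrable (fun p => Complex.exp (-z * X p) * H p) μ := by
  refine (h.integrable z.re hz).mono' (h.aestronglyMeasurable_exp_mul z)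
    (Filter.Eventually.of_forall fun p => ?_)
  rw [norm_mul, norm_cexp_neg_mul_ofReal]

theorem LaplaceIntegrable.mul_left (h : LaplaceIntegrable μ X H) :
    LaplaceIntegrable μ X (fun p => (X p : ℂ) * H p) := by
  have hX := h.measurable
  have hm : AEStronglyMeasurable (fun p => (X p : ℂ) * H p) μ :=
    (Measurable.aestronglyMeasurable (by fun_prop)).mul h.aestronglyMeasurable
  refine ⟨hX, h.nonneg, hm, fun x hx => ?_⟩
  refine ((h.integrable (x / 2) (by positivity)).const_mul (2 / x)).mono'
    ((Measurable.aestronglyMeasurable (by fun_prop)).mul hm.norm) ?_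
  filter_upwards [h.nonneg] with p hp
  rw [norm_mul, norm_norm, norm_mul, Complex.norm_real, Real.norm_of_nonneg hp,
    Real.norm_of_nonneg (Real.exp_pos _).le]
  have h1 : X p ≤ 2 / x * Real.exp (x / 2 * X p) := by
    have := Real.add_one_le_exp (x / 2 * X p)
    rw [div_mul_eq_mul_div, le_div_iff₀ hx]
    linarith
  have h2 : Real.exp (-x * X p) * Real.exp (x / 2 * X p) = Real.exp (-(x / 2) * X p) := by
    rw [← Real.exp_add]; congr 1; ring
  calc Real.exp (-x * X p) * (X p * ‖H p‖)
      ≤ Real.exp (-x * X p) * (2 / x * Real.exp (x / 2 * X p) * ‖H p‖) := by gcongr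
    _ = 2 / x * (Real.exp (-x * X p) * Real.exp (x / 2 * X p) * ‖H p‖) := by ring
    _ = _ := by rw [h2]

theorem LaplaceIntegrable.hasDerivAt (h : LaplaceIntegrable μ X H) {z : ℂ} (hz : 0 < z.re) :
    HasDerivAt (laplaceOf μ X H) (-laplaceOf μ X (fun p => (X p : ℂ) * H p) z) z := by
  have hs : {w : ℂ | z.re / 2 < w.re} ∈ nhds z :=
    (isOpen_lt continuous_const Complex.continuous_re).mem_nhds (by simpa using hz)
  have key := hasDerivAt_integral_of_dominated_loc_of_deriv_le (μ := μ) (x₀ := z)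
    (F := fun w p => Complex.exp (-w * X p) * H p)
    (F' := fun w p => -(Complex.exp (-w * X p) * ((X p : ℂ) * H p)))
    (bound := fun p => Real.exp (-(z.re / 2) * X p) * ‖(X p : ℂ) * H p‖) hs
    (Filter.Eventually.of_forall fun w => h.aestronglyMeasurable_exp_mul w)
    (h.integrable_exp_mul hz) (h.mul_left.aestronglyMeasurable_exp_mul z).neg
    (by
      filter_upwards [h.nonneg] with p hp w hw
      rw [norm_neg, norm_mul, norm_cexp_neg_mul_ofReal]
      have : z.re / 2 < w.re := hw
      gcongr)
    (h.mul_left.integrable _ (by positivity))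
    (Filter.Eventually.of_forall fun p w _ => by
      have h1 : HasDerivAt (fun w : ℂ => -w * X p) (-(X p : ℂ)) w := by
        simpa using (hasDerivAt_id w).neg.mul_const (X p : ℂ)
      exact (h1.cexp.mul_const (H p)).congr_deriv (by ring))
  have h2 := key.2
  rw [integral_neg] at h2
  exact h2

theorem LaplaceIntegrable.differentiableOn (h : LaplaceIntegrable μ X H) :
    DifferentiableOn ℂ (laplaceOf μ X H) {z | 0 < z.re} := fun _ hz =>
  (h.hasDerivAt hz).differentiableAt.differentiableWithinAt

/-- A Laplace transform which vanishes on a real half line vanishes on the right half plane. -/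
theorem LaplaceIntegrable.laplaceOf_eq_zero (h : LaplaceIntegrable μ X H) {c : ℝ} (hc : 0 < c)
    (h0 : ∀ x : ℝ, c ≤ x → laplaceOf μ X H x = 0) {z : ℂ} (hz : 0 < z.re) :
    laplaceOf μ X H z = 0 := by
  have hopen : IsOpen {z : ℂ | 0 < z.re} := isOpen_lt continuous_const Complex.continuous_re
  have han := h.differentiableOn.analyticOnNhd hopen
  have hfreq : ∃ᶠ w in nhdsWithin ((c : ℝ) : ℂ) {((c : ℝ) : ℂ)}ᶜ, laplaceOf μ X H w = 0 := by
    have ht : Filter.Tendsto (fun x : ℝ => (x : ℂ)) (nhdsWithin c (Ioi c))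
        (nhdsWithin (c : ℂ) {(c : ℂ)}ᶜ) := by
      refine tendsto_nhdsWithin_iff.mpr
        ⟨(Complex.continuous_ofReal.tendsto c).mono_left nhdsWithin_le_nhds, ?_⟩
      filter_upwards [self_mem_nhdsWithin] with x hx
      simpa using (ne_of_gt (show c < x from hx))
    refine ht.frequently (Filter.Eventually.frequently ?_)
    filter_upwards [self_mem_nhdsWithin] with x hx using h0 x (le_of_lt hx)
  exact han.eqOn_zero_of_preconnected_of_frequently_eq_zero
    ((convex_halfSpace_re_gt 0).isPreconnected) (by simpa using hc) hfreq hz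

/-- Uniqueness for characteristic functions, for the law of `X` under a signed density `q`. -/
theorem integral_comp_mul_eq_zero_of_charFun {q : Ω → ℝ} (hX : Measurable X)
    (hq : Integrable q μ)
    (h0 : ∀ t : ℝ, ∫ p, Complex.exp (t * X p * Complex.I) * (q p : ℂ) ∂μ = 0)
    {G : ℝ → ℝ} (hG : Measurable G) (hGq : Integrable (fun p => G (X p) * q p) μ) :
    ∫ p, G (X p) * q p ∂μ = 0 := by
  have hm1 : AEMeasurable (fun p => ENNReal.ofReal (q p)) μ := hq.1.aemeasurable.ennreal_ofReal
  have hm2 : AEMeasurable (fun p => ENNReal.ofReal (-q p)) μ :=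
    hq.1.aemeasurable.neg.ennreal_ofReal
  have hlt1 : ∀ᵐ p ∂μ, ENNReal.ofReal (q p) < ⊤ := by simp
  have hlt2 : ∀ᵐ p ∂μ, ENNReal.ofReal (-q p) < ⊤ := by simp
  set P := (μ.withDensity fun p => ENNReal.ofReal (q p)).map X with hP
  set N := (μ.withDensity fun p => ENNReal.ofReal (-q p)).map X with hN
  have hf1 : IsFiniteMeasure (μ.withDensity fun p => ENNReal.ofReal (q p)) :=
    isFiniteMeasure_withDensity_ofReal hq.2
  have hf2 : IsFiniteMeasure (μ.withDensity fun p => ENNReal.ofReal (-q p)) :=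
    isFiniteMeasure_withDensity_ofReal hq.neg.2
  have hdiff : ∀ s : ℝ, (ENNReal.ofReal s).toReal - (ENNReal.ofReal (-s)).toReal = s := by
    intro s
    rw [ENNReal.toReal_ofReal', ENNReal.toReal_ofReal']
    rcases le_total 0 s with h | h
    · rw [max_eq_left h, max_eq_right (by linarith)]; ring
    · rw [max_eq_right h, max_eq_left (by linarith)]; ring
  have habs : ∀ s : ℝ, |(ENNReal.ofReal s).toReal| ≤ |s| := by
    intro s
    rw [ENNReal.toReal_ofReal', abs_of_nonneg (le_max_right _ _)]
    exact max_le (le_abs_self s) (abs_nonneg s)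
  have hPN : P = N := by
    apply Measure.ext_of_charFun
    funext t
    rw [charFun_apply_real, charFun_apply_real, hP, hN,
      integral_map hX.aemeasurable (by fun_prop), integral_map hX.aemeasurable (by fun_prop),
      integral_withDensity_eq_integral_toReal_smul₀ hm1 hlt1,
      integral_withDensity_eq_integral_toReal_smul₀ hm2 hlt2, ← sub_eq_zero, ← integral_sub]
    · rw [← h0 t]
      refine integral_congr_ae (Filter.Eventually.of_forall fun p => ?_)
      simp only [Complex.real_smul]
      rw [← sub_mul, ← Complex.ofReal_sub, hdiff, mul_comm]
    · refine hq.mono (by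
        simp only [Complex.real_smul]
        exact (Complex.continuous_ofReal.comp_aestronglyMeasurable
          hm1.ennreal_toReal.aestronglyMeasurable).mul
            (Measurable.aestronglyMeasurable (by fun_prop))) (Filter.Eventually.of_forall fun p => ?_)
      rw [norm_smul, ← Complex.ofReal_mul, Complex.norm_exp_ofReal_mul_I, mul_one]
      exact habs _
    · refine hq.mono (by
        simp only [Complex.real_smul]
        exact (Complex.continuous_ofReal.comp_aestronglyMeasurable
          hm2.ennreal_toReal.aestronglyMeasurable).mul
            (Measurable.aestronglyMeasurable (by fun_prop))) (Filter.Eventually.of_forall fun p => ?_)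
      rw [norm_smul, ← Complex.ofReal_mul, Complex.norm_exp_ofReal_mul_I, mul_one]
      simpa using habs (-q p)
  have hint := congrArg (fun M : Measure ℝ => ∫ s, G s ∂M) hPN
  simp only [hP, hN] at hint
  rw [integral_map hX.aemeasurable hG.aestronglyMeasurable,
    integral_map hX.aemeasurable hG.aestronglyMeasurable,
    integral_withDensity_eq_integral_toReal_smul₀ hm1 hlt1,
    integral_withDensity_eq_integral_toReal_smul₀ hm2 hlt2, ← sub_eq_zero, ← integral_sub] at hint
  · rw [← hint]
    refine integral_congr_ae (Filter.Eventually.of_forall fun p => ?_)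
    simp only [smul_eq_mul]
    rw [← sub_mul, hdiff, mul_comm]
  · refine hGq.mono (AEStronglyMeasurable.smul hm1.ennreal_toReal.aestronglyMeasurable
      (hG.comp hX).aestronglyMeasurable) (Filter.Eventually.of_forall fun p => ?_)
    rw [norm_smul, norm_mul, mul_comm]
    exact mul_le_mul_of_nonneg_left (habs _) (norm_nonneg _)
  · refine hGq.mono (AEStronglyMeasurable.smul hm2.ennreal_toReal.aestronglyMeasurable
      (hG.comp hX).aestronglyMeasurable) (Filter.Eventually.of_forall fun p => ?_)
    rw [norm_smul, norm_mul, mul_comm]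
    exact mul_le_mul_of_nonneg_left (by simpa using habs (-q p)) (norm_nonneg _)

theorem LaplaceIntegrable.integral_comp_mul_eq_zero_of_real {q : Ω → ℝ}
    (h : LaplaceIntegrable μ X (fun p => (q p : ℂ))) {c : ℝ} (hc : 0 < c)
    (h0 : ∀ x : ℝ, c ≤ x → laplaceOf μ X (fun p => (q p : ℂ)) x = 0)
    {G : ℝ → ℝ} (hG : Measurable G) (hGq : Integrable (fun p => G (X p) * q p) μ) :
    ∫ p, G (X p) * q p ∂μ = 0 := by
  have hX := h.measurable
  have hqm : AEStronglyMeasurable q μ := by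
    simpa using h.aestronglyMeasurable.re
  have hq : Integrable (fun p => Real.exp (-X p) * q p) μ := by
    refine (h.integrable 1 one_pos).mono
      ((Measurable.aestronglyMeasurable (by fun_prop)).mul hqm)
      (Filter.Eventually.of_forall fun p => ?_)
    simp
  -- The factor `exp (-X)` makes the density integrable; it is compensated in the test function.
  have hG' : Measurable fun s => G s * Real.exp s := hG.mul Real.measurable_exp
  have hfun : ∀ p, G (X p) * Real.exp (X p) * (Real.exp (-X p) * q p) = G (X p) * q p := by
    intro p
    have : Real.exp (X p) * Real.exp (-X p) = 1 := by rw [← Real.exp_add]; simp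
    linear_combination G (X p) * q p * this
  have := integral_comp_mul_eq_zero_of_charFun hX hq (fun t => ?_) hG' (by simpa only [hfun])
  · simpa only [hfun] using this
  · rw [← h.laplaceOf_eq_zero hc h0 (z := 1 - t * Complex.I) (by simp)]
    refine integral_congr_ae (Filter.Eventually.of_forall fun p => ?_)
    simp only [Complex.ofReal_mul, Complex.ofReal_exp]
    rw [← mul_assoc, ← Complex.exp_add]
    congr 2
    push_cast
    ring

/-- If the Laplace transform of `X` under `H μ` vanishes on a real half line, then `H` is
orthogonal to every function of `X`. -/
theorem LaplaceIntegrable.integral_comp_mul_eq_zero (h : LaplaceIntegrable μ X H) {c : ℝ}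
    (hc : 0 < c) (h0 : ∀ x : ℝ, c ≤ x → laplaceOf μ X H x = 0)
    {G : ℝ → ℝ} (hG : Measurable G) (hGH : Integrable (fun p => (G (X p) : ℂ) * H p) μ) :
    ∫ p, (G (X p) : ℂ) * H p ∂μ = 0 := by
  have hX := h.measurable
  have hre : LaplaceIntegrable μ X (fun p => ((H p).re : ℂ)) := by
    have hm : AEStronglyMeasurable (fun p => ((H p).re : ℂ)) μ :=
      Complex.continuous_ofReal.comp_aestronglyMeasurable
        (Complex.continuous_re.comp_aestronglyMeasurable h.aestronglyMeasurable)
    refine ⟨hX, h.nonneg, hm, fun x hx => (h.integrable x hx).mono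
      ((Measurable.aestronglyMeasurable (by fun_prop)).mul hm.norm)
      (Filter.Eventually.of_forall fun p => ?_)⟩
    rw [norm_mul, norm_mul, norm_norm, norm_norm, Complex.norm_real]
    exact mul_le_mul_of_nonneg_left (Complex.abs_re_le_norm _) (norm_nonneg _)
  have him : LaplaceIntegrable μ X (fun p => ((H p).im : ℂ)) := by
    have hm : AEStronglyMeasurable (fun p => ((H p).im : ℂ)) μ :=
      Complex.continuous_ofReal.comp_aestronglyMeasurable
        (Complex.continuous_im.comp_aestronglyMeasurable h.aestronglyMeasurable)
    refine ⟨hX, h.nonneg, hm, fun x hx => (h.integrable x hx).mono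
      ((Measurable.aestronglyMeasurable (by fun_prop)).mul hm.norm)
      (Filter.Eventually.of_forall fun p => ?_)⟩
    rw [norm_mul, norm_mul, norm_norm, norm_norm, Complex.norm_real]
    exact mul_le_mul_of_nonneg_left (Complex.abs_im_le_norm _) (norm_nonneg _)
  have hexp : ∀ (x : ℝ) (p : Ω), Complex.exp (-(x : ℂ) * X p) = (Real.exp (-x * X p) : ℝ) := by
    intro x p; push_cast; rfl
  apply Complex.ext
  · have h1 := hre.integral_comp_mul_eq_zero_of_real hc (fun x hx => ?_) hG
      (by simpa using hGH.re)
    · have h2 := integral_re hGH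
      simp only [RCLike.re_to_complex, Complex.re_ofReal_mul] at h2
      rw [← h2, h1, Complex.zero_re]
    · have h2 := integral_re (h.integrable_exp_mul (z := x) (by simpa using hc.trans_le hx))
      have h3 := h0 x hx
      simp only [laplaceOf, hexp] at h2 h3 ⊢
      rw [h3] at h2
      simp only [RCLike.re_to_complex, Complex.re_ofReal_mul, Complex.zero_re] at h2
      simp only [← Complex.ofReal_mul]
      rw [integral_complex_ofReal, h2, Complex.ofReal_zero]
  · have h1 := him.integral_comp_mul_eq_zero_of_real hc (fun x hx => ?_) hG
      (by simpa using hGH.im)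
    · have h2 := integral_im hGH
      simp only [RCLike.im_to_complex, Complex.im_ofReal_mul] at h2
      rw [← h2, h1, Complex.zero_im]
    · have h2 := integral_im (h.integrable_exp_mul (z := x) (by simpa using hc.trans_le hx))
      have h3 := h0 x hx
      simp only [laplaceOf, hexp] at h2 h3 ⊢
      rw [h3] at h2
      simp only [RCLike.im_to_complex, Complex.im_ofReal_mul, Complex.zero_im] at h2
      simp only [← Complex.ofReal_mul]
      rw [integral_complex_ofReal, h2, Complex.ofReal_zero]

end Laplace

/-! ### The Macdonald kernel -/

/-- The density of the Macdonald kernel on `(0, ∞)`. -/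
noncomputable def macdonaldWeight (α u : ℝ) : ℝ := u ^ (α - 1 / 2) / √(1 + u)

/-- The variable `√(1 + u)` on `(0, ∞)`. -/
noncomputable def sqrtVar (u : ℝ) : ℝ := √(1 + u)

/-- The Macdonald kernel
`ψ z = ∫₀^∞ u ^ (α - 1/2) (1 + u) ^ (-1/2) exp (-z √(1 + u)) du` for `0 < re z`, a constant multiple
of `z ^ (-α) K_α(z)`. The substitution `t = √(1 + u)` turns it into the usual integral of
`exp (-z t) (t² - 1) ^ (α - 1/2)` over `t > 1`. -/
noncomputable def macdonaldKernel (α : ℝ) : ℂ → ℂ :=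
  laplaceOf (volume.restrict (Ioi (0 : ℝ))) sqrtVar (fun u => (macdonaldWeight α u : ℂ))

/-- The negative of the derivative of the Macdonald kernel. -/
noncomputable def macdonaldKernel' (α : ℝ) : ℂ → ℂ :=
  laplaceOf (volume.restrict (Ioi (0 : ℝ))) sqrtVar
    (fun u => (sqrtVar u : ℂ) * (macdonaldWeight α u : ℂ))

theorem measurable_sqrtVar : Measurable sqrtVar := by unfold sqrtVar; fun_prop

theorem measurable_macdonaldWeight (α : ℝ) : Measurable (macdonaldWeight α) := by
  unfold macdonaldWeight; fun_prop

theorem one_le_sqrtVar {u : ℝ} (hu : 0 < u) : 1 ≤ sqrtVar u :=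
  Real.one_le_sqrt.mpr (by linarith)

theorem sq_sqrtVar {u : ℝ} (hu : 0 < u) : sqrtVar u ^ 2 = 1 + u := Real.sq_sqrt (by linarith)

theorem macdonaldWeight_nonneg {α u : ℝ} (hu : 0 < u) : 0 ≤ macdonaldWeight α u := by
  unfold macdonaldWeight; positivity

theorem sqrtVar_mul_macdonaldWeight {α u : ℝ} (hu : 0 < u) :
    sqrtVar u * macdonaldWeight α u = u ^ (α - 1 / 2) := by
  have : √(1 + u) ≠ 0 := (Real.sqrt_pos.mpr (by linarith)).ne'
  unfold sqrtVar macdonaldWeight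
  field_simp

theorem laplaceIntegrable_macdonaldWeight {α : ℝ} (hα : -(1 / 2 : ℝ) < α) :
    LaplaceIntegrable (volume.restrict (Ioi (0 : ℝ))) sqrtVar
      (fun u => (macdonaldWeight α u : ℂ)) := by
  have hw : Measurable (fun u => (macdonaldWeight α u : ℂ)) :=
    Complex.measurable_ofReal.comp (measurable_macdonaldWeight α)
  have hY := measurable_sqrtVar
  refine ⟨hY, Filter.Eventually.of_forall fun u => Real.sqrt_nonneg _,
    hw.aestronglyMeasurable, fun x hx => ?_⟩
  have hint : IntegrableOn (fun u : ℝ => u ^ (α - 1 / 2) * Real.exp (-x * u ^ (1 / 2 : ℝ)))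
      (Ioi 0) :=
    integrableOn_rpow_mul_exp_neg_mul_rpow (by linarith) (by norm_num) hx
  refine Integrable.mono' hint
    (Measurable.aestronglyMeasurable (by fun_prop)) ?_
  rw [ae_restrict_iff' measurableSet_Ioi]
  refine Filter.Eventually.of_forall fun u (hu : 0 < u) => ?_
  rw [norm_mul, norm_norm, Complex.norm_real, Real.norm_of_nonneg (Real.exp_pos _).le,
    Real.norm_of_nonneg (macdonaldWeight_nonneg hu), mul_comm]
  refine mul_le_mul ?_ (Real.exp_le_exp.mpr ?_) (Real.exp_pos _).le (by positivity)
  · exact div_le_self (by positivity) (one_le_sqrtVar hu)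
  · rw [← Real.sqrt_eq_rpow]
    have : √u ≤ sqrtVar u := Real.sqrt_le_sqrt (by linarith)
    nlinarith

theorem hasDerivAt_macdonaldKernel {α : ℝ} (hα : -(1 / 2 : ℝ) < α) {z : ℂ} (hz : 0 < z.re) :
    HasDerivAt (macdonaldKernel α) (-macdonaldKernel' α z) z :=
  (laplaceIntegrable_macdonaldWeight hα).hasDerivAt hz

/-- The modified Bessel equation `z ψ'' + (2 α + 1) ψ' = z ψ`, solved for the second derivative. It
is the integration by parts of the derivative of `u ^ (α + 1/2) exp (-z √(1 + u))`. -/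
theorem hasDerivAt_macdonaldKernel' {α : ℝ} (hα : -(1 / 2 : ℝ) < α) {z : ℂ} (hz : 0 < z.re) :
    HasDerivAt (macdonaldKernel' α)
      (-(macdonaldKernel α z + (2 * α + 1) / z * macdonaldKernel' α z)) z := by
  have h0 := laplaceIntegrable_macdonaldWeight hα
  have h1 := h0.mul_left
  have h2 := h1.mul_left
  have h3 := h2.mul_left
  have hz0 : z ≠ 0 := by rintro rfl; simp at hz
  refine (h1.hasDerivAt hz).congr_deriv ?_
  set ν := volume.restrict (Ioi (0 : ℝ)) with hν
  set Φ : ℝ → ℂ := fun u => ((u ^ (α + 1 / 2) : ℝ) : ℂ) * Complex.exp (-z * sqrtVar u) with hΦ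
  set Φ' : ℝ → ℂ := fun u => ((α + 1 / 2 : ℝ) : ℂ) *
      (Complex.exp (-z * sqrtVar u) * ((sqrtVar u : ℂ) * (macdonaldWeight α u : ℂ))) -
      z / 2 * (Complex.exp (-z * sqrtVar u) *
        ((sqrtVar u : ℂ) * ((sqrtVar u : ℂ) * (macdonaldWeight α u : ℂ))) -
        Complex.exp (-z * sqrtVar u) * (macdonaldWeight α u : ℂ)) with hΦ'
  have hY2 : ∀ {u : ℝ}, 0 < u → (sqrtVar u : ℂ) ^ 2 = 1 + u := fun {u} hu => by
    rw [← Complex.ofReal_pow, sq_sqrtVar hu]; push_cast; ring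
  have hYw : ∀ {u : ℝ}, 0 < u →
      (sqrtVar u : ℂ) * (macdonaldWeight α u : ℂ) = ((u ^ (α - 1 / 2) : ℝ) : ℂ) := fun {u} hu => by
    rw [← Complex.ofReal_mul, sqrtVar_mul_macdonaldWeight hu]
  have hpow : ∀ {u : ℝ}, 0 < u →
      ((u ^ (α + 1 / 2) : ℝ) : ℂ) = (u : ℂ) * ((u ^ (α - 1 / 2) : ℝ) : ℂ) := fun {u} hu => by
    rw [← Complex.ofReal_mul, ← Real.rpow_one_add' hu.le (by linarith)]
    congr 2; ring
  have hderiv : ∀ u ∈ Ioi (0 : ℝ), HasDerivAt Φ (Φ' u) u := by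
    intro u hu
    have hu : 0 < u := hu
    have hYpos : 0 < sqrtVar u := one_pos.trans_le (one_le_sqrtVar hu)
    have hY0 : (sqrtVar u : ℂ) ≠ 0 := by exact_mod_cast hYpos.ne'
    have d1 : HasDerivAt sqrtVar (1 / (2 * sqrtVar u)) u := by
      have := (((hasDerivAt_id u).const_add 1)).sqrt (by simp only [id]; linarith)
      exact this
    have d2 : HasDerivAt (fun u : ℝ => ((u ^ (α + 1 / 2) : ℝ) : ℂ))
        (((α + 1 / 2) * u ^ (α + 1 / 2 - 1) : ℝ) : ℂ) u :=
      (Real.hasDerivAt_rpow_const (Or.inl hu.ne')).ofReal_comp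
    have d3 := (d1.ofReal_comp.const_mul (-z)).cexp
    refine (d2.mul d3).congr_deriv ?_
    have e1 : α + 1 / 2 - 1 = α - 1 / 2 := by ring
    have e2 : (macdonaldWeight α u : ℂ) = ((u ^ (α - 1 / 2) : ℝ) : ℂ) / sqrtVar u := by
      rw [← hYw hu]; field_simp
    rw [hΦ', e1, hpow hu]
    simp only [e2]
    generalize u ^ (α - 1 / 2) = U
    push_cast
    have := hY2 hu
    field_simp
    linear_combination (U : ℂ) * z * this
  have hi0 := h0.integrable_exp_mul hz
  have hi1 := h1.integrable_exp_mul hz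
  have hi2 := h2.integrable_exp_mul hz
  have hi3 := h3.integrable_exp_mul hz
  have hΦ'int : IntegrableOn Φ' (Ioi 0) :=
    (hi1.const_mul _).sub ((hi2.sub hi0).const_mul _)
  have hΦint : IntegrableOn Φ (Ioi 0) := by
    refine (hi3.sub hi1).congr ?_
    rw [Filter.EventuallyEq, hν, ae_restrict_iff' measurableSet_Ioi]
    refine Filter.Eventually.of_forall fun u (hu : 0 < u) => ?_
    have e1 := hYw hu
    have e2 := hY2 hu
    simp only [hΦ, Pi.sub_apply]
    rw [hpow hu, ← e1]
    linear_combination Complex.exp (-z * sqrtVar u) * (sqrtVar u * macdonaldWeight α u) * e2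
  have hcont : ContinuousWithinAt Φ (Ici 0) 0 := by
    refine ContinuousAt.continuousWithinAt (ContinuousAt.mul ?_ ?_)
    · exact Complex.continuous_ofReal.continuousAt.comp
        (Real.continuousAt_rpow_const _ _ (Or.inr (by linarith)))
    · unfold sqrtVar; fun_prop
  have hlim := tendsto_zero_of_hasDerivAt_of_integrableOn_Ioi hderiv hΦ'int hΦint
  have hFTC := integral_Ioi_of_hasDerivAt_of_tendsto hcont hderiv hΦ'int hlim
  have hΦ0 : Φ 0 = 0 := by
    simp only [hΦ, Real.zero_rpow (show α + 1 / 2 ≠ 0 by linarith), Complex.ofReal_zero, zero_mul]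
  rw [hΦ0, sub_zero] at hFTC
  simp only [hΦ'] at hFTC
  have hi20 : Integrable (fun u => Complex.exp (-z * sqrtVar u) *
      ((sqrtVar u : ℂ) * ((sqrtVar u : ℂ) * (macdonaldWeight α u : ℂ))) -
      Complex.exp (-z * sqrtVar u) * (macdonaldWeight α u : ℂ)) ν := hi2.sub hi0
  rw [integral_sub (hi1.const_mul _) (hi20.const_mul _),
    integral_const_mul, integral_const_mul, integral_sub hi2 hi0] at hFTC
  change _ * macdonaldKernel' α z - z / 2 * (laplaceOf ν sqrtVar _ z - macdonaldKernel α z) = 0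
    at hFTC
  push_cast at hFTC
  generalize laplaceOf ν sqrtVar _ z = A at hFTC ⊢
  field_simp
  linear_combination 2 * hFTC

/-- Exponential decay of Laplace transforms of a variable which is at least `1`. -/
theorem norm_laplaceOf_le {Ω : Type*} [MeasurableSpace Ω] {μ : Measure Ω} {X : Ω → ℝ} {H : Ω → ℂ}
    (h : LaplaceIntegrable μ X H) (hX : ∀ᵐ p ∂μ, 1 ≤ X p) {x y : ℝ} (hx : 0 ≤ x) (hy : 0 < y)
    {z : ℂ} (hz : x + y ≤ z.re) :
    ‖laplaceOf μ X H z‖ ≤ (∫ p, Real.exp (-y * X p) * ‖H p‖ ∂μ) * Real.exp (-x) := by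
  rw [← integral_mul_const]
  refine norm_integral_le_of_norm_le ((h.integrable y hy).mul_const _) ?_
  filter_upwards [hX] with p hp
  rw [norm_mul, norm_cexp_neg_mul_ofReal, mul_right_comm, ← Real.exp_add]
  gcongr
  nlinarith

theorem ae_one_le_sqrtVar : ∀ᵐ u ∂(volume.restrict (Ioi (0 : ℝ))), 1 ≤ sqrtVar u := by
  rw [ae_restrict_iff' measurableSet_Ioi]
  exact Filter.Eventually.of_forall fun u hu => one_le_sqrtVar hu

/-- Bounds for the kernel and its derivative, uniform in the half plane `c ≤ re k`. -/
theorem exists_norm_macdonaldKernel_le {α : ℝ} (hα : -(1 / 2 : ℝ) < α) {c r₀ : ℝ} (hc : 0 < c)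
    (hr₀ : 0 < r₀) : ∃ D : ℝ, 0 ≤ D ∧ ∀ k : ℂ, c ≤ k.re → ∀ r : ℝ, r₀ ≤ r →
      ‖macdonaldKernel α (k * r)‖ ≤ D * Real.exp (-(c / 2) * r) ∧
      ‖macdonaldKernel' α (k * r)‖ ≤ D * Real.exp (-(c / 2) * r) := by
  have h0 := laplaceIntegrable_macdonaldWeight hα
  have h1 := h0.mul_left
  set D₀ := ∫ u, Real.exp (-(c / 2 * r₀) * sqrtVar u) * ‖(macdonaldWeight α u : ℂ)‖
    ∂(volume.restrict (Ioi (0 : ℝ))) with hD₀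
  set D₁ := ∫ u, Real.exp (-(c / 2 * r₀) * sqrtVar u) *
    ‖(sqrtVar u : ℂ) * (macdonaldWeight α u : ℂ)‖ ∂(volume.restrict (Ioi (0 : ℝ))) with hD₁
  have hD₀' : 0 ≤ D₀ := integral_nonneg fun u => by positivity
  have hD₁' : 0 ≤ D₁ := integral_nonneg fun u => by positivity
  refine ⟨D₀ + D₁, by positivity, fun k hk r hr => ?_⟩
  have hr0 : 0 < r := hr₀.trans_le hr
  have hz : c / 2 * r + c / 2 * r₀ ≤ (k * r).re := by
    rw [Complex.re_mul_ofReal]; nlinarith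
  have b0 := norm_laplaceOf_le h0 ae_one_le_sqrtVar (x := c / 2 * r) (by positivity)
    (by positivity) hz
  have b1 := norm_laplaceOf_le h1 ae_one_le_sqrtVar (x := c / 2 * r) (by positivity)
    (by positivity) hz
  rw [← neg_mul (c / 2) r] at b0 b1
  exact ⟨b0.trans (by gcongr; linarith), b1.trans (by gcongr; linarith)⟩

section Radial

variable {α : ℝ} {k : ℂ}

theorem re_mul_ofReal_pos (hk : 0 < k.re) {r : ℝ} (hr : 0 < r) : 0 < (k * r).re := by
  rw [Complex.re_mul_ofReal]; positivity

theorem hasDerivAt_macdonaldKernel_mul (hα : -(1 / 2 : ℝ) < α) (hk : 0 < k.re) {r : ℝ}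
    (hr : 0 < r) : HasDerivAt (fun r : ℝ => macdonaldKernel α (k * r))
      (-k * macdonaldKernel' α (k * r)) r := by
  have h1 : HasDerivAt (fun r : ℝ => k * (r : ℂ)) k r := by
    simpa using (Complex.ofRealCLM.hasDerivAt (x := r)).const_mul k
  exact ((hasDerivAt_macdonaldKernel hα (re_mul_ofReal_pos hk hr)).comp r h1).congr_deriv (by ring)

theorem hasDerivAt_macdonaldKernel'_mul (hα : -(1 / 2 : ℝ) < α) (hk : 0 < k.re) {r : ℝ}
    (hr : 0 < r) : HasDerivAt (fun r : ℝ => -k * macdonaldKernel' α (k * r))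
      (k ^ 2 * macdonaldKernel α (k * r) -
        ((2 * α + 1) / r : ℝ) * (-k * macdonaldKernel' α (k * r))) r := by
  have h1 : HasDerivAt (fun r : ℝ => k * (r : ℂ)) k r := by
    simpa using (Complex.ofRealCLM.hasDerivAt (x := r)).const_mul k
  have hk0 : k ≠ 0 := by rintro rfl; simp at hk
  have hr0 : (r : ℂ) ≠ 0 := by exact_mod_cast hr.ne'
  refine (((hasDerivAt_macdonaldKernel' hα (re_mul_ofReal_pos hk hr)).comp r h1).const_mul
    (-k)).congr_deriv ?_
  push_cast
  field_simp
  ring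

theorem contDiffOn_macdonaldKernel_mul (hα : -(1 / 2 : ℝ) < α) (hk : 0 < k.re) :
    ContDiffOn ℝ ∞ (fun r : ℝ => macdonaldKernel α (k * r)) (Ioi 0) := by
  have hopen : IsOpen {z : ℂ | 0 < z.re} := isOpen_lt continuous_const Complex.continuous_re
  have h1 : ContDiffOn ℂ ∞ (macdonaldKernel α) {z | 0 < z.re} :=
    (laplaceIntegrable_macdonaldWeight hα).differentiableOn.contDiffOn hopen
  refine (h1.restrict_scalars ℝ).comp (t := {z : ℂ | 0 < z.re}) ?_
    fun r hr => re_mul_ofReal_pos hk hr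
  exact (contDiff_const.mul Complex.ofRealCLM.contDiff).contDiffOn

end Radial

/-! ### The Bessel measure and test functions -/

section BesselMeasure

variable {α : ℝ}

theorem measurable_besselDensity (α : ℝ) :
    Measurable fun r : ℝ => ENNReal.ofReal (r ^ (2 * α + 1)) := by fun_prop

theorem ae_besselMeasure_pos (α : ℝ) : ∀ᵐ r ∂(besselMeasure α), 0 < r :=
  (withDensity_absolutelyContinuous _ _).ae_le (ae_restrict_mem measurableSet_Ioi)

theorem besselMeasure_absolutelyContinuous (α : ℝ) :
    besselMeasure α ≪ volume.restrict (Ioi (0 : ℝ)) :=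
  withDensity_absolutelyContinuous _ _

theorem absolutelyContinuous_besselMeasure (α : ℝ) :
    volume.restrict (Ioi (0 : ℝ)) ≪ besselMeasure α := by
  refine withDensity_absolutelyContinuous' (measurable_besselDensity α).aemeasurable ?_
  filter_upwards [ae_restrict_mem measurableSet_Ioi] with r hr
  exact (ENNReal.ofReal_pos.mpr (Real.rpow_pos_of_pos hr _)).ne'

instance (α : ℝ) : SFinite (besselMeasure α) := by
  unfold besselMeasure; infer_instance

theorem integrable_besselMeasure_iff {g : ℝ → ℝ} :
    Integrable g (besselMeasure α) ↔ IntegrableOn (fun r => r ^ (2 * α + 1) * g r) (Ioi 0) := by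
  rw [besselMeasure, integrable_withDensity_iff_integrable_smul' (measurable_besselDensity α)
    (by simp)]
  refine integrable_congr ?_
  filter_upwards [ae_restrict_mem measurableSet_Ioi] with r hr
  rw [smul_eq_mul, ENNReal.toReal_ofReal (Real.rpow_nonneg (le_of_lt hr) _)]

theorem memLp_exp_neg_besselMeasure (hα : -(1 / 2 : ℝ) < α) {b : ℝ} (hb : 0 < b) :
    MemLp (fun r => Real.exp (-b * r)) 2 (besselMeasure α) := by
  rw [memLp_two_iff_integrable_sq (by fun_prop), integrable_besselMeasure_iff]
  have := integrableOn_rpow_mul_exp_neg_mul_rpow (p := 1) (s := 2 * α + 1) (b := 2 * b)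
    (by linarith) one_pos (by positivity)
  refine this.congr_fun (fun r _ => ?_) measurableSet_Ioi
  simp only [Real.rpow_one]
  rw [← Real.exp_nat_mul]
  congr 2
  push_cast; ring

theorem integrable_norm_mul_exp_neg (hα : -(1 / 2 : ℝ) < α) {u : ℝ → ℂ}
    (hu : MemLp u 2 (besselMeasure α)) {b : ℝ} (hb : 0 < b) :
    Integrable (fun r => ‖u r‖ * Real.exp (-b * r)) (besselMeasure α) :=
  hu.norm.integrable_mul (memLp_exp_neg_besselMeasure hα hb)

/-- Square integrable functions are integrable near the origin. -/
theorem integrableOn_Ioo_of_memLp_two (hα : -(1 / 2 : ℝ) < α) {u : ℝ → ℂ}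
    (hu : MemLp u 2 (besselMeasure α)) (η : ℝ) : IntegrableOn u (Ioo 0 η) (besselMeasure α) := by
  refine ((integrable_norm_mul_exp_neg hα hu one_pos).integrableOn.const_mul (Real.exp η)).mono'
    hu.1.restrict ?_
  filter_upwards [ae_restrict_mem measurableSet_Ioo] with r hr
  rw [mul_left_comm, ← Real.exp_add]
  refine le_mul_of_one_le_right (norm_nonneg _) (Real.one_le_exp ?_)
  linarith [hr.2]

end BesselMeasure

section TestFunctions

variable {α a : ℝ}

theorem besselOp_apply_of_hasDerivAt {φ φ₁ : ℝ → ℂ} {φ₂ : ℂ} {r : ℝ} (hr : 0 < r)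
    (h1 : ∀ᶠ s in nhds r, HasDerivAt φ (φ₁ s) s) (h2 : HasDerivAt φ₁ φ₂ r) :
    besselOp α a φ r =
      φ₂ + ((2 * α + 1) / r : ℝ) * φ₁ r - (a ^ 2 : ℝ) * φ r := by
  have hd : (fun s : ℝ => (s ^ (2 * α + 1) : ℝ) • deriv φ s) =ᶠ[nhds r]
      fun s => (s ^ (2 * α + 1) : ℝ) • φ₁ s := by
    filter_upwards [h1] with s hs
    rw [hs.deriv]
  have h3 : HasDerivAt (fun s : ℝ => (s ^ (2 * α + 1) : ℝ) • φ₁ s)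
      ((r ^ (2 * α + 1) : ℝ) • φ₂ + ((2 * α + 1) * r ^ (2 * α + 1 - 1) : ℝ) • φ₁ r) r :=
    (Real.hasDerivAt_rpow_const (Or.inl hr.ne')).smul h2
  have e1 : r ^ (-(2 * α + 1)) * r ^ (2 * α + 1) = 1 := by
    rw [← Real.rpow_add hr]; simp
  have e2 : r ^ (-(2 * α + 1)) * ((2 * α + 1) * r ^ (2 * α + 1 - 1)) = (2 * α + 1) / r := by
    rw [mul_left_comm, ← Real.rpow_add hr, div_eq_mul_inv, ← Real.rpow_neg_one r]
    congr 2; ring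
  rw [besselOp, hd.deriv_eq, h3.deriv, smul_add, smul_smul, smul_smul, e1, e2, one_smul,
    Complex.real_smul, Complex.real_smul]

theorem besselOp_apply_of_notMem_tsupport {φ : ℝ → ℂ} {r : ℝ} (hr : r ∉ tsupport φ) :
    besselOp α a φ r = 0 := by
  have h0 : φ =ᶠ[nhds r] fun _ => 0 := notMem_tsupport_iff_eventuallyEq.mp hr
  have h1 : deriv φ =ᶠ[nhds r] fun _ => 0 := by simpa using h0.deriv
  have h2 : (fun s : ℝ => (s ^ (2 * α + 1) : ℝ) • deriv φ s) =ᶠ[nhds r] fun _ => 0 := by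
    filter_upwards [h1] with s hs
    rw [hs, smul_zero]
  rw [besselOp, h2.deriv_eq, h0.eq_of_nhds]
  simp

theorem tsupport_besselOp_subset (φ : ℝ → ℂ) : tsupport (besselOp α a φ) ⊆ tsupport φ :=
  closure_minimal (fun r hr => by
    by_contra h
    exact hr (besselOp_apply_of_notMem_tsupport h)) (isClosed_tsupport φ)

theorem IsTestFunction.besselOp {φ : ℝ → ℂ} (hφ : IsTestFunction φ) :
    IsTestFunction (besselOp α a φ) := by
  refine ⟨contDiff_iff_contDiffAt.mpr fun r => ?_,
    hφ.hasCompactSupport.of_isClosed_subset (isClosed_tsupport _) (tsupport_besselOp_subset φ),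
    (tsupport_besselOp_subset φ).trans hφ.tsupport_subset⟩
  by_cases hr : r ∈ tsupport φ
  · have hr0 : 0 < r := hφ.tsupport_subset hr
    have hφ' : ContDiff ℝ ∞ (deriv φ) := (contDiff_infty_iff_deriv.mp hφ.smooth).2
    have hp : ∀ p : ℝ, ContDiffOn ℝ ∞ (fun s : ℝ => s ^ p) (Ioi 0) := fun p s hs =>
      (Real.contDiffAt_rpow_const_of_ne (ne_of_gt hs)).contDiffWithinAt
    have h1 : ContDiffOn ℝ ∞ (fun s : ℝ => (s ^ (2 * α + 1) : ℝ) • deriv φ s) (Ioi 0) :=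
      (hp _).smul hφ'.contDiffOn
    have h2 : ContDiffOn ℝ ∞ (deriv fun s : ℝ => (s ^ (2 * α + 1) : ℝ) • deriv φ s) (Ioi 0) :=
      h1.deriv_of_isOpen isOpen_Ioi (by simp)
    have h3 : ContDiffOn ℝ ∞ (_root_.besselOp α a φ) (Ioi 0) :=
      ((hp _).smul h2).sub (ContDiffOn.const_smul (a ^ 2) hφ.smooth.contDiffOn)
    exact h3.contDiffAt (isOpen_Ioi.mem_nhds hr0)
  · have h0 : _root_.besselOp α a φ =ᶠ[nhds r] fun _ => 0 := by
      filter_upwards [(isClosed_tsupport φ).isOpen_compl.mem_nhds hr] with s hs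
      exact besselOp_apply_of_notMem_tsupport hs
    exact contDiffAt_const.congr_of_eventuallyEq h0

theorem tsupport_iterate_besselOp_subset (φ : ℝ → ℂ) (m : ℕ) :
    tsupport ((besselOp α a)^[m] φ) ⊆ tsupport φ := by
  induction m with
  | zero => exact subset_rfl
  | succ m ih =>
    rw [Function.iterate_succ_apply']
    exact (tsupport_besselOp_subset _).trans ih

/-- Consecutive distributional powers are related by a single application of the operator. -/
theorem IsWeakBesselPow.succ {f g g' : ℝ → ℂ} {m : ℕ} (h : IsWeakBesselPow α a m f g)
    (h' : IsWeakBesselPow α a (m + 1) f g') {φ : ℝ → ℂ} (hφ : IsTestFunction φ) :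
    ∫ r, g r * besselOp α a φ r ∂(besselMeasure α) = ∫ r, g' r * φ r ∂(besselMeasure α) := by
  rw [← h _ hφ.besselOp, ← h' φ hφ, Function.iterate_succ_apply]

/-- Distributional powers are local: they vanish where the function does. -/
theorem IsWeakBesselPow.ae_eq_zero (hα : -(1 / 2 : ℝ) < α) {f g : ℝ → ℂ} {m : ℕ} {η : ℝ}
    (h : IsWeakBesselPow α a m f g) (hg : MemLp g 2 (besselMeasure α))
    (hf0 : ∀ᵐ r ∂(besselMeasure α), r < η → f r = 0) :
    ∀ᵐ r ∂(besselMeasure α), r < η → g r = 0 := by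
  have key := isOpen_Ioo.ae_eq_zero_of_integral_contDiff_smul_eq_zero
    (integrableOn_Ioo_of_memLp_two hα hg η).locallyIntegrableOn (fun φ hφ hc hs => ?_)
  · filter_upwards [key, ae_besselMeasure_pos α] with r hr hpos hlt using hr ⟨hpos, hlt⟩
  · have hsupp : tsupport (fun r => (φ r : ℂ)) ⊆ tsupport φ :=
      closure_mono fun r hr => by
        simpa using hr
    have hφ' : IsTestFunction fun r => (φ r : ℂ) :=
      ⟨Complex.ofRealCLM.contDiff.comp hφ,
        hc.of_isClosed_subset (isClosed_tsupport _) hsupp,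
        hsupp.trans (hs.trans fun r hr => hr.1)⟩
    have h1 := h _ hφ'
    calc ∫ r, φ r • g r ∂(besselMeasure α)
        = ∫ r, g r * (φ r : ℂ) ∂(besselMeasure α) := by
          simp only [Complex.real_smul, mul_comm]
      _ = 0 := by
        rw [← h1]
        refine integral_eq_zero_of_ae ?_
        filter_upwards [hf0] with r hr
        by_cases hlt : r < η
        · simp [hr hlt]
        · have : r ∉ tsupport ((besselOp α a)^[m] fun r => (φ r : ℂ)) := fun hmem =>
            hlt (hs (hsupp (tsupport_iterate_besselOp_subset _ _ hmem))).2
          simp [image_eq_zero_of_notMem_tsupport this]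

end TestFunctions

/-! ### Pairing with solutions which are not compactly supported -/

/-- A smooth cut-off on the half line: it vanishes for `r ≤ η / 3` and for `r ≥ n + 1`, and equals
`1` on `[2 η / 3, n]`. -/
noncomputable def radialCutoff (η : ℝ) (n : ℕ) (r : ℝ) : ℝ :=
  Real.smoothTransition (3 * r / η - 1) * Real.smoothTransition (n + 1 - r)

theorem radialCutoff_of_le {η : ℝ} (hη : 0 < η) (n : ℕ) {r : ℝ} (hr : 2 * η / 3 ≤ r) :
    radialCutoff η n r = Real.smoothTransition (n + 1 - r) := by
  rw [radialCutoff, Real.smoothTransition.one_of_one_le, one_mul]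
  rw [le_sub_iff_add_le, le_div_iff₀ hη]
  linarith

theorem exists_norm_deriv_smoothTransition_le : ∃ B : ℝ, 0 ≤ B ∧
    ∀ x, |deriv Real.smoothTransition x| ≤ B ∧ |deriv (deriv Real.smoothTransition) x| ≤ B := by
  have hs : ContDiff ℝ ∞ Real.smoothTransition := Real.smoothTransition.contDiff
  have hs1 : ContDiff ℝ ∞ (deriv Real.smoothTransition) := (contDiff_infty_iff_deriv.mp hs).2
  have hs2 : ContDiff ℝ ∞ (deriv (deriv Real.smoothTransition)) :=
    (contDiff_infty_iff_deriv.mp hs1).2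
  have hc : HasCompactSupport (deriv Real.smoothTransition) := by
    refine HasCompactSupport.intro (isCompact_Icc (a := (0 : ℝ)) (b := 1)) fun x hx => ?_
    rcases lt_or_ge x 0 with h | h
    · have : Real.smoothTransition =ᶠ[nhds x] fun _ => 0 := by
        filter_upwards [eventually_lt_nhds h] with y hy
        exact Real.smoothTransition.zero_of_nonpos hy.le
      simpa using this.deriv_eq
    · have h1 : 1 < x := by
        by_contra h2
        exact hx ⟨h, not_lt.mp h2⟩
      have : Real.smoothTransition =ᶠ[nhds x] fun _ => 1 := by
        filter_upwards [eventually_gt_nhds h1] with y hy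
        exact Real.smoothTransition.one_of_one_le hy.le
      simpa using this.deriv_eq
  obtain ⟨B₁, h1⟩ := hs1.continuous.bounded_above_of_compact_support hc
  obtain ⟨B₂, h2⟩ := hs2.continuous.bounded_above_of_compact_support hc.deriv
  refine ⟨max B₁ B₂, (norm_nonneg _).trans ((h1 0).trans (le_max_left _ _)), fun x =>
    ⟨(h1 x).trans (le_max_left _ _), (h2 x).trans (le_max_right _ _)⟩⟩

theorem isTestFunction_radialCutoff_mul {κ : ℝ → ℂ} (hκ : ContDiffOn ℝ ∞ κ (Ioi 0)) {η : ℝ}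
    (hη : 0 < η) (n : ℕ) : IsTestFunction fun r => (radialCutoff η n r : ℂ) * κ r := by
  have hzero : ∀ r ∉ Icc (η / 3) (n + 1), (radialCutoff η n r : ℂ) * κ r = 0 := by
    intro r hr
    have : radialCutoff η n r = 0 := by
      rw [radialCutoff]
      rcases lt_or_ge r (η / 3) with h | h
      · rw [Real.smoothTransition.zero_of_nonpos, zero_mul]
        rw [sub_nonpos, div_le_one hη]; linarith
      · have h1 : (n + 1 : ℝ) < r := by
          by_contra h2
          exact hr ⟨h, not_lt.mp h2⟩
        rw [Real.smoothTransition.zero_of_nonpos (x := n + 1 - r) (by linarith), mul_zero]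
    simp [this]
  have hsupp : tsupport (fun r => (radialCutoff η n r : ℂ) * κ r) ⊆ Icc (η / 3) (n + 1) :=
    closure_minimal (fun r hr => by
      by_contra h
      exact hr (hzero r h)) isClosed_Icc
  have hcut : ContDiff ℝ ∞ (radialCutoff η n) := by
    have hs : ContDiff ℝ ∞ Real.smoothTransition := Real.smoothTransition.contDiff
    exact (hs.comp (((contDiff_const.mul contDiff_id).div_const _).sub contDiff_const)).mul
      (hs.comp (contDiff_const.sub contDiff_id))
  refine ⟨contDiff_iff_contDiffAt.mpr fun r => ?_, isCompact_Icc.of_isClosed_subset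
    (isClosed_tsupport _) hsupp, hsupp.trans fun r hr => ?_⟩
  · rcases lt_or_ge 0 r with h | h
    · exact ((Complex.ofRealCLM.contDiff.comp hcut).contDiffAt).mul
        (hκ.contDiffAt (isOpen_Ioi.mem_nhds h))
    · refine (contDiffAt_const (c := (0 : ℂ))).congr_of_eventuallyEq ?_
      filter_upwards [eventually_lt_nhds (show r < η / 3 by linarith [div_pos hη three_pos])]
        with s hs
      exact hzero s fun h => absurd h.1 (not_le.mpr hs)
  · exact (div_pos hη three_pos).trans_le hr.1

/-- Away from the origin, the cut-off produces only the error terms coming from the derivatives of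
its outer factor. -/
theorem besselOp_radialCutoff_mul {α a : ℝ} {κ κ₁ : ℝ → ℂ} {Λ : ℂ}
    (h1 : ∀ r, 0 < r → HasDerivAt κ (κ₁ r) r)
    (h2 : ∀ r, 0 < r → HasDerivAt κ₁ (Λ * κ r - ((2 * α + 1) / r : ℝ) * κ₁ r) r)
    {η : ℝ} (hη : 0 < η) (n : ℕ) {r : ℝ} (hr : η ≤ r) :
    besselOp α a (fun r => (radialCutoff η n r : ℂ) * κ r) r =
      (Λ - (a ^ 2 : ℝ)) * (Real.smoothTransition (n + 1 - r) * κ r) +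
      ((deriv (deriv Real.smoothTransition) (n + 1 - r) : ℝ) * κ r -
        2 * (deriv Real.smoothTransition (n + 1 - r) : ℝ) * κ₁ r -
        ((2 * α + 1) / r : ℝ) * (deriv Real.smoothTransition (n + 1 - r) : ℝ) * κ r) := by
  have hr0 : 0 < r := hη.trans_le hr
  have hs : ContDiff ℝ ∞ Real.smoothTransition := Real.smoothTransition.contDiff
  have hs1 : ContDiff ℝ ∞ (deriv Real.smoothTransition) := (contDiff_infty_iff_deriv.mp hs).2
  have hsub : ∀ s : ℝ, HasDerivAt (fun s : ℝ => (n + 1 - s : ℝ)) (-1) s := fun s => by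
    simpa using (hasDerivAt_id s).const_sub (n + 1 : ℝ)
  have dT : ∀ s : ℝ, HasDerivAt (fun s : ℝ => ((Real.smoothTransition (n + 1 - s) : ℝ) : ℂ))
      ((-deriv Real.smoothTransition (n + 1 - s) : ℝ) : ℂ) s := fun s =>
    (((hs.differentiable (by simp) _).hasDerivAt.comp s (hsub s)).congr_deriv
      (by ring)).ofReal_comp
  have dT1 : ∀ s : ℝ, HasDerivAt
      (fun s : ℝ => ((-deriv Real.smoothTransition (n + 1 - s) : ℝ) : ℂ))
      ((deriv (deriv Real.smoothTransition) (n + 1 - s) : ℝ) : ℂ) s := fun s =>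
    (((hs1.differentiable (by simp) _).hasDerivAt.comp s (hsub s)).neg.congr_deriv
      (by ring)).ofReal_comp
  have hev : ∀ᶠ s in nhds r, HasDerivAt (fun r => (radialCutoff η n r : ℂ) * κ r)
      (((-deriv Real.smoothTransition (n + 1 - s) : ℝ) : ℂ) * κ s +
        (Real.smoothTransition (n + 1 - s) : ℂ) * κ₁ s) s := by
    filter_upwards [eventually_gt_nhds (show 2 * η / 3 < r by linarith)] with s hs
    have hs0 : 0 < s := lt_trans (by positivity) hs
    refine ((dT s).mul (h1 s hs0)).congr_of_eventuallyEq ?_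
    filter_upwards [eventually_gt_nhds hs] with t ht
    simp only [Pi.mul_apply, radialCutoff_of_le hη n ht.le]
  have hd2 := ((dT1 r).mul (h1 r hr0)).add ((dT r).mul (h2 r hr0))
  rw [besselOp_apply_of_hasDerivAt hr0 hev hd2]
  rw [radialCutoff_of_le hη n (by linarith)]
  push_cast
  ring

/-- If `v` is the image of `u` in the sense of distributions, both are square integrable and vanish
near the origin, then `u` and `v` may be paired with exponentially decaying solutions of the
eigenvalue equation, regardless of their behaviour at the origin. -/
theorem integral_mul_eigenfunction {α a : ℝ} (hα : -(1 / 2 : ℝ) < α) {u v : ℝ → ℂ}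
    (hu : MemLp u 2 (besselMeasure α)) (hv : MemLp v 2 (besselMeasure α))
    (huv : ∀ φ, IsTestFunction φ →
      ∫ r, u r * besselOp α a φ r ∂(besselMeasure α) = ∫ r, v r * φ r ∂(besselMeasure α))
    {η : ℝ} (hη : 0 < η) (hu0 : ∀ᵐ r ∂(besselMeasure α), r < η → u r = 0)
    (hv0 : ∀ᵐ r ∂(besselMeasure α), r < η → v r = 0)
    {κ κ₁ : ℝ → ℂ} {Λ : ℂ} (hκ : ContDiffOn ℝ ∞ κ (Ioi 0))
    (h1 : ∀ r, 0 < r → HasDerivAt κ (κ₁ r) r)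
    (h2 : ∀ r, 0 < r → HasDerivAt κ₁ (Λ * κ r - ((2 * α + 1) / r : ℝ) * κ₁ r) r)
    {D b : ℝ} (hb : 0 < b)
    (hbd : ∀ r, η ≤ r → ‖κ r‖ ≤ D * Real.exp (-b * r) ∧ ‖κ₁ r‖ ≤ D * Real.exp (-b * r)) :
    ∫ r, v r * κ r ∂(besselMeasure α) =
      (Λ - (a ^ 2 : ℝ)) * ∫ r, u r * κ r ∂(besselMeasure α) := by
  obtain ⟨B, hB0, hB⟩ := exists_norm_deriv_smoothTransition_le
  set φ : ℕ → ℝ → ℂ := fun n r => (radialCutoff η n r : ℂ) * κ r with hφ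
  have hφt : ∀ n, IsTestFunction (φ n) := isTestFunction_radialCutoff_mul hκ hη
  have hp : 0 < 2 * α + 1 := by linarith
  have hcut : ∀ (n : ℕ) {r : ℝ}, η ≤ r → radialCutoff η n r = Real.smoothTransition (n + 1 - r) :=
    fun n r hr => radialCutoff_of_le hη n (by linarith)
  have hone : ∀ r : ℝ, ∀ᶠ n : ℕ in Filter.atTop, 1 < (n + 1 - r : ℝ) := fun r => by
    filter_upwards [Filter.eventually_gt_atTop ⌈r⌉₊] with n hn
    have := (Nat.le_ceil r).trans_lt (Nat.cast_lt.mpr hn)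
    linarith
  have hT01 : ∀ x, ‖((Real.smoothTransition x : ℝ) : ℂ)‖ ≤ 1 := fun x => by
    rw [Complex.norm_real, Real.norm_of_nonneg (Real.smoothTransition.nonneg x)]
    exact Real.smoothTransition.le_one x
  have hlimv : Filter.Tendsto (fun n => ∫ r, v r * φ n r ∂(besselMeasure α)) Filter.atTop
      (nhds (∫ r, v r * κ r ∂(besselMeasure α))) := by
    refine tendsto_integral_of_dominated_convergence
      (fun r => D * (‖v r‖ * Real.exp (-b * r)))
      (fun n => hv.1.mul (hφt n).smooth.continuous.aestronglyMeasurable)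
      ((integrable_norm_mul_exp_neg hα hv hb).const_mul D) (fun n => ?_) ?_
    · filter_upwards [hv0] with r hr
      rcases lt_or_ge r η with h | h
      · simp [hr h]
      · simp only [hφ, hcut n h]
        rw [norm_mul, norm_mul]
        calc ‖v r‖ * (‖((Real.smoothTransition (n + 1 - r) : ℝ) : ℂ)‖ * ‖κ r‖)
            ≤ ‖v r‖ * (1 * (D * Real.exp (-b * r))) := by
              gcongr
              · exact hT01 _
              · exact (hbd r h).1
          _ = _ := by ring
    · filter_upwards [hv0] with r hr
      rcases lt_or_ge r η with h | h
      · simp [hr h]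
      · refine tendsto_const_nhds.congr' ?_
        filter_upwards [hone r] with n hn
        simp only [hφ, hcut n h, Real.smoothTransition.one_of_one_le hn.le]
        simp
  have hlimu : Filter.Tendsto (fun n => ∫ r, u r * besselOp α a (φ n) r ∂(besselMeasure α))
      Filter.atTop (nhds (∫ r, u r * ((Λ - (a ^ 2 : ℝ)) * κ r) ∂(besselMeasure α))) := by
    refine tendsto_integral_of_dominated_convergence
      (fun r => (‖Λ - (a ^ 2 : ℝ)‖ + 3 * B + (2 * α + 1) / η * B) * D *
        (‖u r‖ * Real.exp (-b * r)))
      (fun n => hu.1.mul (hφt n).besselOp.smooth.continuous.aestronglyMeasurable)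
      ((integrable_norm_mul_exp_neg hα hu hb).const_mul _) (fun n => ?_) ?_
    · filter_upwards [hu0] with r hr
      rcases lt_or_ge r η with h | h
      · simp [hr h]
      · have hr0 : 0 < r := hη.trans_le h
        obtain ⟨k0, k1⟩ := hbd r h
        obtain ⟨t1, t2⟩ := hB (n + 1 - r)
        have t0 := hT01 (n + 1 - r)
        have hpr : (2 * α + 1) / r ≤ (2 * α + 1) / η := by gcongr
        simp only [hφ, besselOp_radialCutoff_mul h1 h2 hη n h]
        rw [norm_mul]
        set E := D * Real.exp (-b * r) with hE
        have hE0 : 0 ≤ E := (norm_nonneg _).trans k0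
        calc _ ≤ ‖u r‖ * (‖Λ - (a ^ 2 : ℝ)‖ * (1 * E) + (B * E + 2 * B * E +
              (2 * α + 1) / η * B * E)) := by
              refine mul_le_mul_of_nonneg_left ?_ (norm_nonneg _)
              refine (norm_add_le _ _).trans (add_le_add ?_ ?_)
              · rw [norm_mul, norm_mul]; gcongr
              · refine (norm_sub_le _ _).trans (add_le_add ((norm_sub_le _ _).trans
                  (add_le_add ?_ ?_)) ?_)
                · rw [norm_mul, Complex.norm_real, Real.norm_eq_abs]; gcongr
                · rw [norm_mul, norm_mul, Complex.norm_real, Real.norm_eq_abs, Complex.norm_two]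
                  gcongr
                · rw [norm_mul, norm_mul, Complex.norm_real, Complex.norm_real, Real.norm_eq_abs,
                    Real.norm_eq_abs, abs_of_pos (div_pos hp hr0)]
                  gcongr
          _ = _ := by rw [hE]; ring
    · filter_upwards [hu0] with r hr
      rcases lt_or_ge r η with h | h
      · simp [hr h]
      · refine tendsto_const_nhds.congr' ?_
        filter_upwards [hone r] with n hn
        have hT : Real.smoothTransition =ᶠ[nhds (n + 1 - r : ℝ)] fun _ => 1 := by
          filter_upwards [eventually_gt_nhds hn] with y hy
          exact Real.smoothTransition.one_of_one_le hy.le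
        have hT1 : deriv Real.smoothTransition =ᶠ[nhds (n + 1 - r : ℝ)] fun _ => 0 := by
          simpa using hT.deriv
        have hT2 : deriv (deriv Real.smoothTransition) (n + 1 - r : ℝ) = 0 := by
          simpa using hT1.deriv_eq
        simp only [hφ, besselOp_radialCutoff_mul h1 h2 hη n h, hT.eq_of_nhds, hT1.eq_of_nhds, hT2]
        simp
  have hlim : Filter.Tendsto (fun n => ∫ r, v r * φ n r ∂(besselMeasure α)) Filter.atTop
      (nhds (∫ r, u r * ((Λ - (a ^ 2 : ℝ)) * κ r) ∂(besselMeasure α))) :=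
    hlimu.congr fun n => huv _ (hφt n)
  rw [tendsto_nhds_unique hlimv hlim, ← integral_const_mul]
  exact integral_congr_ae (Filter.Eventually.of_forall fun r => by ring)

/-! ### The transform with the Macdonald kernel -/

section Transform

variable {α a : ℝ} {f : ℝ → ℂ} {η : ℝ}

/-- The variable `r √(1 + u)`, in which the transform with the Macdonald kernel is a Laplace
transform. -/
noncomputable def radialVar (p : ℝ × ℝ) : ℝ := p.1 * sqrtVar p.2

/-- The density of the complex measure whose Laplace transform, in the variable `radialVar`, is the
transform of `f` with the Macdonald kernel. -/
noncomputable def radialDensity (α : ℝ) (f : ℝ → ℂ) (p : ℝ × ℝ) : ℂ :=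
  f p.1 * (macdonaldWeight α p.2 : ℂ)

theorem ae_prod_sqrtVar (hf0 : ∀ᵐ r ∂(besselMeasure α), r < η → f r = 0) :
    ∀ᵐ p ∂((besselMeasure α).prod (volume.restrict (Ioi (0 : ℝ)))),
      0 < p.1 ∧ (p.1 < η → f p.1 = 0) ∧ 1 ≤ sqrtVar p.2 := by
  filter_upwards [Measure.quasiMeasurePreserving_fst.ae hf0,
    Measure.quasiMeasurePreserving_fst.ae (ae_besselMeasure_pos α),
    Measure.quasiMeasurePreserving_snd.ae ae_one_le_sqrtVar] with p h1 h2 h3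
  exact ⟨h2, h1, h3⟩

theorem laplaceIntegrable_radialDensity (hα : -(1 / 2 : ℝ) < α)
    (hf : MemLp f 2 (besselMeasure α)) (hη : 0 < η)
    (hf0 : ∀ᵐ r ∂(besselMeasure α), r < η → f r = 0) :
    LaplaceIntegrable ((besselMeasure α).prod (volume.restrict (Ioi (0 : ℝ)))) radialVar
      (radialDensity α f) := by
  have hY := measurable_sqrtVar
  have hX : Measurable radialVar := by unfold radialVar; fun_prop
  have hw := laplaceIntegrable_macdonaldWeight hα
  have hH : AEStronglyMeasurable (radialDensity α f)
      ((besselMeasure α).prod (volume.restrict (Ioi (0 : ℝ)))) :=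
    hf.1.comp_fst.mul hw.aestronglyMeasurable.comp_snd
  refine ⟨hX, ?_, hH, fun x hx => ?_⟩
  · filter_upwards [ae_prod_sqrtVar hf0] with p hp
    exact mul_nonneg hp.1.le (zero_le_one.trans hp.2.2)
  · refine ((integrable_norm_mul_exp_neg hα hf (half_pos hx)).mul_prod
      (hw.integrable (x / 2 * η) (by positivity))).mono'
      ((Measurable.aestronglyMeasurable (by fun_prop)).mul hH.norm) ?_
    filter_upwards [ae_prod_sqrtVar hf0] with p hp
    obtain ⟨h1, h2, h3⟩ := hp
    rcases lt_or_ge p.1 η with h | h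
    · simp [radialDensity, h2 h]
    · rw [norm_mul, norm_norm, Real.norm_of_nonneg (Real.exp_pos _).le, radialDensity, norm_mul]
      have h4 : Real.exp (-x * radialVar p) ≤
          Real.exp (-(x / 2) * p.1) * Real.exp (-(x / 2 * η) * sqrtVar p.2) := by
        rw [← Real.exp_add]
        apply Real.exp_le_exp.mpr
        rw [radialVar]
        have h5 : p.1 ≤ p.1 * sqrtVar p.2 := le_mul_of_one_le_right h1.le h3
        have h6 : η * sqrtVar p.2 ≤ p.1 * sqrtVar p.2 := by gcongr
        nlinarith
      calc _ ≤ Real.exp (-(x / 2) * p.1) * Real.exp (-(x / 2 * η) * sqrtVar p.2) *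
            (‖f p.1‖ * ‖(macdonaldWeight α p.2 : ℂ)‖) := by gcongr
        _ = _ := by ring

theorem laplaceOf_radialDensity (hα : -(1 / 2 : ℝ) < α)
    (hf : MemLp f 2 (besselMeasure α)) (hη : 0 < η)
    (hf0 : ∀ᵐ r ∂(besselMeasure α), r < η → f r = 0) {k : ℂ} (hk : 0 < k.re) :
    laplaceOf ((besselMeasure α).prod (volume.restrict (Ioi (0 : ℝ)))) radialVar
      (radialDensity α f) k = ∫ r, f r * macdonaldKernel α (k * r) ∂(besselMeasure α) := by
  rw [laplaceOf, integral_prod _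
    ((laplaceIntegrable_radialDensity hα hf hη hf0).integrable_exp_mul hk)]
  refine integral_congr_ae (Filter.Eventually.of_forall fun r => ?_)
  simp only [macdonaldKernel, laplaceOf]
  rw [← integral_const_mul]
  refine integral_congr_ae (Filter.Eventually.of_forall fun u => ?_)
  simp only [radialVar, radialDensity]
  push_cast
  rw [show -k * ((r : ℂ) * sqrtVar u) = -(k * r) * sqrtVar u by ring]
  ring

/-- The transform with the Macdonald kernel diagonalises the Bessel operator, on functions which
vanish near the origin. -/
theorem integral_weakBesselPow_mul_macdonaldKernel (hα : -(1 / 2 : ℝ) < α)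
    (hf : MemLp f 2 (besselMeasure α)) {g : ℕ → ℝ → ℂ}
    (hg : ∀ m : ℕ, IsWeakBesselPow α a m f (g m))
    (hgL2 : ∀ m : ℕ, MemLp (g m) 2 (besselMeasure α)) (hη : 0 < η)
    (hf0 : ∀ᵐ r ∂(besselMeasure α), r < η → f r = 0) {k : ℂ} (hk : 0 < k.re) (m : ℕ) :
    ∫ r, g (m + 1) r * macdonaldKernel α (k * r) ∂(besselMeasure α) =
      (k ^ 2 - (a ^ 2 : ℝ)) ^ (m + 1) *
        ∫ r, f r * macdonaldKernel α (k * r) ∂(besselMeasure α) := by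
  obtain ⟨D, -, hD⟩ := exists_norm_macdonaldKernel_le hα hk hη
  have hg0 : ∀ m, ∀ᵐ r ∂(besselMeasure α), r < η → g m r = 0 := fun m =>
    (hg m).ae_eq_zero hα (hgL2 m) hf0
  have hbd : ∀ r : ℝ, η ≤ r →
      ‖macdonaldKernel α (k * r)‖ ≤ D * (1 + ‖k‖) * Real.exp (-(k.re / 2) * r) ∧
      ‖-k * macdonaldKernel' α (k * r)‖ ≤ D * (1 + ‖k‖) * Real.exp (-(k.re / 2) * r) := by
    intro r hr
    obtain ⟨h0, h1⟩ := hD k le_rfl r hr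
    have hE : 0 ≤ D * Real.exp (-(k.re / 2) * r) := (norm_nonneg _).trans h0
    have hk0 := norm_nonneg k
    refine ⟨h0.trans ?_, ?_⟩
    · nlinarith
    · rw [norm_mul, norm_neg]
      calc ‖k‖ * ‖macdonaldKernel' α (k * r)‖ ≤ ‖k‖ * (D * Real.exp (-(k.re / 2) * r)) := by gcongr
        _ ≤ _ := by nlinarith
  have step : ∀ {u v : ℝ → ℂ}, MemLp u 2 (besselMeasure α) → MemLp v 2 (besselMeasure α) →
      (∀ φ, IsTestFunction φ → ∫ r, u r * besselOp α a φ r ∂(besselMeasure α) =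
        ∫ r, v r * φ r ∂(besselMeasure α)) →
      (∀ᵐ r ∂(besselMeasure α), r < η → u r = 0) →
      (∀ᵐ r ∂(besselMeasure α), r < η → v r = 0) →
      ∫ r, v r * macdonaldKernel α (k * r) ∂(besselMeasure α) =
        (k ^ 2 - (a ^ 2 : ℝ)) * ∫ r, u r * macdonaldKernel α (k * r) ∂(besselMeasure α) :=
    fun hu hv huv hu0 hv0 => integral_mul_eigenfunction hα hu hv huv hη hu0 hv0
      (contDiffOn_macdonaldKernel_mul hα hk)
      (fun r hr => hasDerivAt_macdonaldKernel_mul hα hk hr)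
      (fun r hr => hasDerivAt_macdonaldKernel'_mul hα hk hr) (half_pos hk) hbd
  induction m with
  | zero =>
    rw [zero_add, pow_one]
    exact step hf (hgL2 1) (fun φ hφ => hg 1 φ hφ) hf0 (hg0 1)
  | succ m ih =>
    rw [step (hgL2 (m + 1)) (hgL2 (m + 2)) (fun φ hφ => (hg (m + 1)).succ (hg (m + 2)) hφ)
      (hg0 _) (hg0 _), ih]
    ring

theorem exists_norm_integral_mul_macdonaldKernel_le (hα : -(1 / 2 : ℝ) < α) (hη : 0 < η) {c : ℝ}
    (hc : 0 < c) : ∃ K : ℝ, 0 ≤ K ∧ ∀ g : ℝ → ℂ, MemLp g 2 (besselMeasure α) →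
      (∀ᵐ r ∂(besselMeasure α), r < η → g r = 0) → ∀ k : ℂ, c ≤ k.re →
      ‖∫ r, g r * macdonaldKernel α (k * r) ∂(besselMeasure α)‖ ≤
        K * (eLpNorm g 2 (besselMeasure α)).toReal := by
  obtain ⟨D, hD0, hD⟩ := exists_norm_macdonaldKernel_le hα hc hη
  have he := memLp_exp_neg_besselMeasure hα (half_pos hc)
  set N := (eLpNorm (fun r => Real.exp (-(c / 2) * r)) 2 (besselMeasure α)).toReal with hN
  refine ⟨D * N, mul_nonneg hD0 ENNReal.toReal_nonneg, fun g hg hg0 k hk => ?_⟩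
  have hint := integrable_norm_mul_exp_neg hα hg (half_pos hc)
  have h1 : ‖∫ r, g r * macdonaldKernel α (k * r) ∂(besselMeasure α)‖ ≤
      ∫ r, D * (‖g r‖ * Real.exp (-(c / 2) * r)) ∂(besselMeasure α) := by
    refine norm_integral_le_of_norm_le (hint.const_mul D) ?_
    filter_upwards [hg0] with r hr
    rcases lt_or_ge r η with h | h
    · simp [hr h]
    · rw [norm_mul, mul_left_comm]
      have := (hD k hk r h).1
      gcongr
  have h2 : ∫ r, ‖g r‖ * Real.exp (-(c / 2) * r) ∂(besselMeasure α) ≤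
      (eLpNorm g 2 (besselMeasure α)).toReal * N := by
    have h3 := eLpNorm_smul_le_mul_eLpNorm (p := 2) (q := 2) (r := 1) he.1 hg.norm.1
    have h4 : ∫ r, ‖g r‖ * Real.exp (-(c / 2) * r) ∂(besselMeasure α) =
        (eLpNorm ((fun r => ‖g r‖) • fun r => Real.exp (-(c / 2) * r)) 1
          (besselMeasure α)).toReal := by
      rw [eLpNorm_one_eq_lintegral_enorm]
      simp only [Pi.smul_apply', smul_eq_mul]
      rw [← integral_norm_eq_lintegral_enorm hint.1]
      refine integral_congr_ae (Filter.Eventually.of_forall fun r => ?_)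
      exact (Real.norm_of_nonneg (mul_nonneg (norm_nonneg _) (Real.exp_pos _).le)).symm
    rw [h4, hN, ← eLpNorm_norm g, ← ENNReal.toReal_mul]
    exact ENNReal.toReal_mono (ENNReal.mul_ne_top hg.norm.eLpNorm_ne_top he.eLpNorm_ne_top) h3
  rw [integral_const_mul] at h1
  calc _ ≤ _ := h1
    _ ≤ D * ((eLpNorm g 2 (besselMeasure α)).toReal * N) := by gcongr
    _ = _ := by ring

/-- Under Carleman's condition the transform with the Macdonald kernel vanishes at large real
points. -/
theorem laplaceOf_radialDensity_eq_zero (hα : -(1 / 2 : ℝ) < α)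
    (hf : MemLp f 2 (besselMeasure α)) {g : ℕ → ℝ → ℂ}
    (hg : ∀ m : ℕ, IsWeakBesselPow α a m f (g m))
    (hgL2 : ∀ m : ℕ, MemLp (g m) 2 (besselMeasure α))
    (hCarleman : ∑' m : ℕ,
      (eLpNorm (g (m + 1)) 2 (besselMeasure α)) ^ (-(1 / (2 * ((m : ℝ) + 1)))) = ⊤)
    (hη : 0 < η) (hf0 : ∀ᵐ r ∂(besselMeasure α), r < η → f r = 0) {c : ℝ}
    (hc : 4 * |a| + 1 ≤ c) :
    laplaceOf ((besselMeasure α).prod (volume.restrict (Ioi (0 : ℝ)))) radialVar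
      (radialDensity α f) c = 0 := by
  have ha0 := abs_nonneg a
  have hc0 : 0 < c := by linarith
  set F := laplaceOf ((besselMeasure α).prod (volume.restrict (Ioi (0 : ℝ)))) radialVar
      (radialDensity α f) with hF
  have hg0 : ∀ m, ∀ᵐ r ∂(besselMeasure α), r < η → g m r = 0 := fun m =>
    (hg m).ae_eq_zero hα (hgL2 m) hf0
  obtain ⟨K, hK0, hK⟩ := exists_norm_integral_mul_macdonaldKernel_le hα hη (half_pos hc0)
  set M : ℕ → ℝ := fun m => (eLpNorm (g (m + 1)) 2 (besselMeasure α)).toReal with hM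
  have hM0 : ∀ m, 0 ≤ M m := fun m => ENNReal.toReal_nonneg
  have hbound : ∀ (m : ℕ) (z : ℂ), c / 2 < z.re → ‖F z‖ * (‖z‖ ^ 2 / 2) ^ (m + 1) ≤ K * M m := by
    intro m z hz
    have hz0 : 0 < z.re := by linarith
    have h1 := hK _ (hgL2 (m + 1)) (hg0 (m + 1)) z hz.le
    rw [integral_weakBesselPow_mul_macdonaldKernel hα hf hg hgL2 hη hf0 hz0,
      ← laplaceOf_radialDensity hα hf hη hf0 hz0, norm_mul, norm_pow] at h1
    refine le_trans ?_ h1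
    rw [mul_comm]
    gcongr
    have h2 : ‖z ^ 2‖ - ‖((a ^ 2 : ℝ) : ℂ)‖ ≤ ‖z ^ 2 - (a ^ 2 : ℝ)‖ := norm_sub_norm_le _ _
    rw [norm_pow, Complex.norm_real, Real.norm_of_nonneg (sq_nonneg a)] at h2
    have h3 : 2 * |a| ≤ ‖z‖ := by linarith [Complex.re_le_norm z]
    have h4 : a ^ 2 = |a| ^ 2 := (sq_abs a).symm
    nlinarith
  -- If some norm is zero, its summand is infinite, and `F` vanishes without Carleman's condition.
  by_cases hMz : ∃ m, M m = 0
  · obtain ⟨m, hm⟩ := hMz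
    have h1 := hbound m c (by simpa using hc0)
    rw [hm, mul_zero] at h1
    have h2 : 0 < (‖(c : ℂ)‖ ^ 2 / 2) ^ (m + 1) := by
      rw [Complex.norm_real, Real.norm_of_nonneg hc0.le]; positivity
    have h3 : ‖F c‖ ≤ 0 := nonpos_of_mul_nonpos_left h1 h2
    exact norm_le_zero_iff.mp h3
  · have hMpos : ∀ m, 0 < M m := fun m => lt_of_le_of_ne (hM0 m) fun h => hMz ⟨m, h.symm⟩
    set x : ℕ → ℝ := fun m => M m ^ (-(1 / (2 * ((m : ℝ) + 1)))) / √2 with hx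
    have hxpow : ∀ (m : ℕ) (z : ℂ), (x m * ‖z‖) ^ (2 * (m + 1)) =
        (M m)⁻¹ * (‖z‖ ^ 2 / 2) ^ (m + 1) := by
      intro m z
      have h1 : (M m ^ (-(1 / (2 * ((m : ℝ) + 1))))) ^ (2 * (m + 1)) = (M m)⁻¹ := by
        rw [← Real.rpow_natCast, ← Real.rpow_mul (hM0 m), ← Real.rpow_neg_one]
        congr 1
        push_cast
        field_simp
      rw [hx, div_mul_eq_mul_div, div_pow, mul_pow, h1, pow_mul, pow_mul,
        Real.sq_sqrt zero_le_two, div_pow, mul_div_assoc]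
    refine eq_zero_of_carleman_bound (C := K * (eLpNorm f 2 (besselMeasure α)).toReal + K) hc0
      ((laplaceIntegrable_radialDensity hα hf hη hf0).differentiableOn.mono fun z hz =>
        lt_trans (half_pos hc0) hz) (x := x) (fun m => by have := hMpos m; positivity) ?_
      (fun z hz => ?_) (fun m z hz => ?_)
    · intro hsum
      have h1 : Summable fun m => M m ^ (-(1 / (2 * ((m : ℝ) + 1)))) := by
        refine (hsum.mul_right √2).congr fun m => ?_
        simp only [hx]
        field_simp
      refine h1.tsum_ofReal_ne_top ?_
      rw [← hCarleman]
      refine tsum_congr fun m => ?_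
      rw [← ENNReal.ofReal_rpow_of_pos (hMpos m), ENNReal.ofReal_toReal (hgL2 _).eLpNorm_ne_top]
    · rw [hF, laplaceOf_radialDensity hα hf hη hf0 (lt_trans (half_pos hc0) hz)]
      linarith [hK f hf hf0 z (le_of_lt hz)]
    · rw [hxpow]
      have h1 := hbound m z hz
      have h2 : ‖F z‖ * ((M m)⁻¹ * (‖z‖ ^ 2 / 2) ^ (m + 1)) ≤ K := by
        rw [mul_left_comm, inv_mul_le_iff₀ (hMpos m)]
        linarith
      have h3 : 0 ≤ K * (eLpNorm f 2 (besselMeasure α)).toReal :=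
        mul_nonneg hK0 ENNReal.toReal_nonneg
      linarith

end Transform

/-! ### Injectivity of the transform -/

/-- The weight `r ^ (-2 α)`, in the form in which it arises from a Gamma integral. -/
noncomputable def gaussWeight (α r : ℝ) : ℝ := r * (1 / r ^ 2) ^ (α + 1 / 2)

theorem mul_exp_neg_mul_sq_le {x s : ℝ} (hx : 0 < x) :
    s * Real.exp (-x * s ^ 2) ≤ Real.exp (1 / x) * Real.exp (-1 * s) := by
  have h1 : s ≤ Real.exp s := by linarith [Real.add_one_le_exp s]
  calc s * Real.exp (-x * s ^ 2) ≤ Real.exp s * Real.exp (-x * s ^ 2) := by gcongr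
    _ = Real.exp (s + -x * s ^ 2) := (Real.exp_add _ _).symm
    _ ≤ Real.exp (1 / x + -1 * s) := by
      apply Real.exp_le_exp.mpr
      have h2 : 1 / x + -1 * s - (s + -x * s ^ 2) = x * (s - 1 / x) ^ 2 := by field_simp; ring
      have h3 : 0 ≤ x * (s - 1 / x) ^ 2 := by positivity
      linarith
    _ = _ := Real.exp_add _ _

/-- Integrating a Gaussian against the density of the Macdonald kernel gives a Gaussian. -/
theorem integral_radialVar_mul_exp_neg_sq {α : ℝ} (hα : -(1 / 2 : ℝ) < α) {x r : ℝ} (hx : 0 < x)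
    (hr : 0 < r) :
    ∫ u in Ioi 0, radialVar (r, u) * Real.exp (-x * radialVar (r, u) ^ 2) * macdonaldWeight α u =
      (1 / x) ^ (α + 1 / 2) * Real.Gamma (α + 1 / 2) *
        (Real.exp (-x * r ^ 2) * gaussWeight α r) := by
  have h1 := Real.integral_rpow_mul_exp_neg_mul_Ioi (a := α + 1 / 2) (r := x * r ^ 2)
    (by linarith) (by positivity)
  have h2 : (1 / (x * r ^ 2)) ^ (α + 1 / 2) = (1 / x) ^ (α + 1 / 2) * (1 / r ^ 2) ^ (α + 1 / 2) := by
    rw [← Real.mul_rpow (by positivity) (by positivity)]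
    congr 1
    field_simp
  calc _ = ∫ u in Ioi 0, r * Real.exp (-x * r ^ 2) *
        (u ^ (α + 1 / 2 - 1) * Real.exp (-(x * r ^ 2 * u))) := by
        refine setIntegral_congr_fun measurableSet_Ioi fun u hu => ?_
        have hu : 0 < u := hu
        have e1 := sqrtVar_mul_macdonaldWeight (α := α) hu
        have e2 : Real.exp (-x * (r * sqrtVar u) ^ 2) =
            Real.exp (-x * r ^ 2) * Real.exp (-(x * r ^ 2 * u)) := by
          rw [← Real.exp_add, mul_pow, sq_sqrtVar hu]; congr 1; ring
        have e3 : α + 1 / 2 - 1 = α - 1 / 2 := by ring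
        simp only [radialVar]
        rw [e2, e3, ← e1]
        ring
    _ = _ := by
      rw [integral_const_mul, h1, h2, gaussWeight]
      ring

theorem laplaceIntegrable_gaussWeight {α : ℝ} (hα : -(1 / 2 : ℝ) < α) {f : ℝ → ℂ}
    (hf : MemLp f 2 (besselMeasure α)) {η : ℝ} (hη : 0 < η)
    (hf0 : ∀ᵐ r ∂(besselMeasure α), r < η → f r = 0) :
    LaplaceIntegrable (besselMeasure α) (fun r => r ^ 2) (fun r => f r * (gaussWeight α r : ℂ)) := by
  have hq : Measurable (gaussWeight α) := by unfold gaussWeight; fun_prop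
  have hH : AEStronglyMeasurable (fun r => f r * (gaussWeight α r : ℂ)) (besselMeasure α) :=
    hf.1.mul (Complex.measurable_ofReal.comp hq).aestronglyMeasurable
  refine ⟨by fun_prop, Filter.Eventually.of_forall fun r => sq_nonneg r, hH, fun x hx => ?_⟩
  refine ((integrable_norm_mul_exp_neg hα hf one_pos).const_mul
    (Real.exp (1 / x) * (1 / η ^ 2) ^ (α + 1 / 2))).mono'
    ((Measurable.aestronglyMeasurable (by fun_prop)).mul hH.norm) ?_
  filter_upwards [hf0] with r hr
  rcases lt_or_ge r η with h | h
  · simp [hr h]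
  · have hr0 : 0 < r := hη.trans_le h
    have h1 := mul_exp_neg_mul_sq_le (s := r) hx
    have h2 : (1 / r ^ 2) ^ (α + 1 / 2) ≤ (1 / η ^ 2) ^ (α + 1 / 2) := by
      apply Real.rpow_le_rpow (by positivity) _ (by linarith)
      gcongr
    have h3 : 0 ≤ gaussWeight α r := by unfold gaussWeight; positivity
    rw [norm_mul, norm_norm, Real.norm_of_nonneg (Real.exp_pos _).le, norm_mul, Complex.norm_real,
      Real.norm_of_nonneg h3, gaussWeight]
    calc Real.exp (-x * r ^ 2) * (‖f r‖ * (r * (1 / r ^ 2) ^ (α + 1 / 2)))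
        = ‖f r‖ * ((r * Real.exp (-x * r ^ 2)) * (1 / r ^ 2) ^ (α + 1 / 2)) := by ring
      _ ≤ ‖f r‖ * ((Real.exp (1 / x) * Real.exp (-1 * r)) * (1 / η ^ 2) ^ (α + 1 / 2)) := by gcongr
      _ = _ := by ring

/-- If the transform of `f` with the Macdonald kernel vanishes at all large real points, then so do
all Gaussian integrals of `f`. -/
theorem laplaceOf_gaussWeight_eq_zero {α : ℝ} (hα : -(1 / 2 : ℝ) < α) {f : ℝ → ℂ}
    (hf : MemLp f 2 (besselMeasure α)) {η : ℝ} (hη : 0 < η)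
    (hf0 : ∀ᵐ r ∂(besselMeasure α), r < η → f r = 0) {c : ℝ} (hc : 0 < c)
    (h0 : ∀ x : ℝ, c ≤ x → laplaceOf ((besselMeasure α).prod (volume.restrict (Ioi (0 : ℝ))))
      radialVar (radialDensity α f) x = 0) {x : ℝ} (hx : 0 < x) :
    laplaceOf (besselMeasure α) (fun r => r ^ 2) (fun r => f r * (gaussWeight α r : ℂ)) x = 0 := by
  have hL := laplaceIntegrable_radialDensity hα hf hη hf0
  have hX := hL.measurable
  set G : ℝ → ℝ := fun s => s * Real.exp (-x * s ^ 2) with hG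
  have hGm : Measurable G := by fun_prop
  have hint : Integrable (fun p => (G (radialVar p) : ℂ) * radialDensity α f p)
      ((besselMeasure α).prod (volume.restrict (Ioi (0 : ℝ)))) := by
    refine ((hL.integrable 1 one_pos).const_mul (Real.exp (1 / x))).mono'
      ((Complex.measurable_ofReal.comp (hGm.comp hX)).aestronglyMeasurable.mul
        hL.aestronglyMeasurable) ?_
    filter_upwards [hL.nonneg] with p hp
    rw [norm_mul, Complex.norm_real, Real.norm_of_nonneg (mul_nonneg hp (Real.exp_pos _).le),
      ← mul_assoc]
    exact mul_le_mul_of_nonneg_right (mul_exp_neg_mul_sq_le hx) (norm_nonneg _)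
  have h1 := hL.integral_comp_mul_eq_zero hc h0 hGm hint
  rw [integral_prod _ hint] at h1
  set A := (1 / x) ^ (α + 1 / 2) * Real.Gamma (α + 1 / 2) with hA
  have hA0 : (A : ℂ) ≠ 0 := by
    have := Real.Gamma_pos_of_pos (s := α + 1 / 2) (by linarith)
    have : 0 < A := by positivity
    exact_mod_cast this.ne'
  have h2 : (A : ℂ) * laplaceOf (besselMeasure α) (fun r => r ^ 2)
      (fun r => f r * (gaussWeight α r : ℂ)) x = 0 := by
    rw [← h1, laplaceOf, ← integral_const_mul]
    refine integral_congr_ae ?_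
    filter_upwards [ae_besselMeasure_pos α] with r hr
    have h3 := integral_radialVar_mul_exp_neg_sq hα hx hr
    have h4 : ∫ u in Ioi 0, (G (radialVar (r, u)) : ℂ) * radialDensity α f (r, u) =
        f r * ((∫ u in Ioi 0, radialVar (r, u) * Real.exp (-x * radialVar (r, u) ^ 2) *
          macdonaldWeight α u : ℝ) : ℂ) := by
      rw [← integral_complex_ofReal, ← integral_const_mul]
      refine integral_congr_ae (Filter.Eventually.of_forall fun u => ?_)
      simp only [hG, radialDensity]
      push_cast
      ring
    rw [h4, h3, ← hA]
    push_cast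
    ring
  exact (mul_eq_zero.mp h2).resolve_left hA0

/-- A function is determined by its Gaussian integrals. -/
theorem ae_eq_zero_of_laplaceOf_sq_eq_zero {μ : Measure ℝ} (hμ : ∀ᵐ r ∂μ, 0 < r) {H : ℝ → ℂ}
    (hL : LaplaceIntegrable μ (fun r => r ^ 2) H)
    (h0 : ∀ x : ℝ, 0 < x → laplaceOf μ (fun r => r ^ 2) H x = 0) : ∀ᵐ r ∂μ, H r = 0 := by
  have hint : Integrable (fun r => Complex.exp (-1 * ((r ^ 2 : ℝ) : ℂ)) * H r) μ :=
    hL.integrable_exp_mul (z := 1) (by simp)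
  have key := hint.ae_eq_zero_of_forall_setIntegral_eq_zero fun s hs _ => ?_
  · filter_upwards [key] with r hr
    exact (mul_eq_zero.mp hr).resolve_left (Complex.exp_ne_zero _)
  · -- On the half line every measurable set is described by a condition on the square.
    set G : ℝ → ℝ := (Real.sqrt ⁻¹' s).indicator fun y => Real.exp (-y) with hG
    have hGm : Measurable G :=
      Measurable.indicator (by fun_prop) (Real.continuous_sqrt.measurable hs)
    have heq : ∀ᵐ r ∂μ, (G (r ^ 2) : ℂ) * H r =
        s.indicator (fun r => Complex.exp (-1 * ((r ^ 2 : ℝ) : ℂ)) * H r) r := by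
      filter_upwards [hμ] with r hr
      by_cases hrs : r ∈ s
      · rw [indicator_of_mem hrs, hG, indicator_of_mem (by simpa [Real.sqrt_sq hr.le] using hrs)]
        push_cast
        ring_nf
      · rw [indicator_of_notMem hrs, hG,
          indicator_of_notMem (by simpa [Real.sqrt_sq hr.le] using hrs)]
        simp
    rw [← integral_indicator hs, ← integral_congr_ae heq]
    exact hL.integral_comp_mul_eq_zero one_pos (fun x hx => h0 x (one_pos.trans_le hx)) hGm
      ((hint.indicator hs).congr (Filter.EventuallyEq.symm heq))

theorem mainTheorem9 (α a : ℝ) (hα : -(1 / 2 : ℝ) < α) (ha : a ≠ 0)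
    (f : ℝ → ℂ) (hf : MemLp f 2 (besselMeasure α))
    (g : ℕ → ℝ → ℂ)
    (hg : ∀ m : ℕ, IsWeakBesselPow α a m f (g m))
    (hgL2 : ∀ m : ℕ, MemLp (g m) 2 (besselMeasure α))
    (hCarleman : ∑' m : ℕ,
      (eLpNorm (g (m + 1)) 2 (besselMeasure α)) ^ (-(1 / (2 * ((m : ℝ) + 1)))) = ⊤)
    (hvanish : ∃ η : ℝ, 0 < η ∧ ∀ᵐ r ∂(volume.restrict (Ioo (0 : ℝ) η)), f r = 0) :
    ∀ᵐ r ∂(volume.restrict (Ioi (0 : ℝ))), f r = 0 := by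
  obtain ⟨η, hη, hfη⟩ := hvanish
  have hf0 : ∀ᵐ r ∂(besselMeasure α), r < η → f r = 0 := by
    rw [ae_restrict_iff' measurableSet_Ioo] at hfη
    have h : ∀ᵐ r ∂(volume.restrict (Ioi (0 : ℝ))), r < η → f r = 0 := by
      rw [ae_restrict_iff' measurableSet_Ioi]
      filter_upwards [hfη] with r hr hpos hlt using hr ⟨hpos, hlt⟩
    exact (besselMeasure_absolutelyContinuous α).ae_le h
  have hc : (0 : ℝ) < 4 * |a| + 1 := by positivity
  have hzero := ae_eq_zero_of_laplaceOf_sq_eq_zero (ae_besselMeasure_pos α)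
    (laplaceIntegrable_gaussWeight hα hf hη hf0) fun x hx =>
      laplaceOf_gaussWeight_eq_zero hα hf hη hf0 hc
        (fun y hy => laplaceOf_radialDensity_eq_zero hα hf hg hgL2 hCarleman hη hf0 hy) hx
  refine (absolutelyContinuous_besselMeasure α).ae_le ?_
  filter_upwards [hzero, ae_besselMeasure_pos α] with r hr hpos
  have hq : 0 < gaussWeight α r := by unfold gaussWeight; positivity
  exact (mul_eq_zero.mp hr).resolve_right (by exact_mod_cast hq.ne')
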